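/- Let $\phi:\mathbb R\to[0,+\infty]$ be convex and lower semicontinuous with $\phi(1)=0$, $\phi(x)=+\infty$ for $x<0$, and superlinear growth $\lim_{x\to\infty}\phi(x)/x=+\infty$. Let $P$ be a probability measure on a measurable space $(\Omega,\mathcal F)$, $\tau>0$, $B\ge 0$, and let $X:\Omega\to[-B,B]$ be measurable. For a divergence function $\psi$ and a probability measure $Q$ on $(\Omega,\mathcal F)$ put $$\mathcal R^{\psi}_{Q}(X)=\sup\Big\{\int X\zeta\,dQ:\ \zeta\ge 0 \text{ measurable},\ \int\zeta\,dQ=1,\ \int\psi(\zeta)\,dQ\le\tau\Big\}.$$ Write $\mathcal R(X)=\mathcal R^{\phi}_P(X)$. For $n\ge 1$ and $\omega_1,\dots,\omega_n$ drawn independently from $P$, let $P_n=\frac1n\sum_{i=1}^n\delta_{\omega_i}$ be the empirical distribution and put $\mathcal R_n(X)=\mathcal R^{\phi}_{P_n}(X)$ and $\mathcal R_{n,L}(X)=\mathcal R^{\phi_L}_{P_n}(X)$, where $\phi_L=\phi$ on $[0,L]$ and $\phi_L=+\infty$ elsewhere. Fix any $D_\phi\ge 1$, let $g_\phi(x)=\inf_{x'\ge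 x}\phi(x')/x'$ for $x\ge D_\phi$, and let $g_\phi^{-1}(y)=\inf\{x\ge D_\phi:\ g_\phi(x)\ge y\}$. For $\epsilon>0$ set $$L(\epsilon)=g_\phi^{-1}\Big(\frac{32B\tau}{\epsilon}\Big),\quad \underline\lambda(\epsilon)=\frac{\epsilon}{8\tau},\quad \overline L(\epsilon)=L(\epsilon)+1+\frac{2(1+L(\epsilon))B}{\underline\lambda(\epsilon)}+\tau,\quad M(\epsilon)=(3+2L(\epsilon))B.$$ Then for every $\epsilon>0$ the following hold (when $B=0$ the lower bounds on $n$ below are read as $0$). (1) For every $\delta\in(0,1)$ and every integer $n\ge 1$ with $$n\ \ge\ \frac{128\,M(\epsilon)^2\log\!\big(256B^2\overline L(\epsilon)^2/(\tau\epsilon^2\delta)\big)}{\epsilon^2},$$ with probability at least $1-\delta$ we have $|\mathcal R(X)-\mathcal R_{n,L(\epsilon)}(X)|\le\epsilon$. (2) For every integer $n\ge 1$ with $$n\ \ge\ \frac{512\,M(\epsilon)^2\log\!\big(8192B^3\overline L(\epsilon)^2/(\tau\epsilon^3)\big)}{\epsilon^2},$$ the random variable $\mathcal R_n(X)$ is integrable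 and $$\mathcal R(X)-\epsilon\ \le\ \mathbb E_{P^{\otimes n}}[\mathcal R_n(X)]\ \le\ \mathcal R(X).$$ -/

import Mathlib

open MeasureTheory Filter Topology
open scoped ENNReal NNReal

noncomputable section

namespace PhiDivergence

/-- A divergence function `φ : ℝ → [0, +∞]`: convex, lower semicontinuous, `φ 1 = 0`,
and `φ = +∞` on the negative half-line. Convexity of an extended-valued function is
`φ (a x + b y) ≤ a φ x + b φ y` for nonnegative weights with `a + b = 1`. -/
structure IsDivergence (φ : ℝ → ℝ≥0∞) : Prop where
  convex : ConvexOn ℝ≥0 Set.univ φ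
  lsc : LowerSemicontinuous φ
  map_one : φ 1 = 0
  map_neg : ∀ x : ℝ, x < 0 → φ x = ⊤

/-- Superlinear growth: `φ x / x → +∞` as `x → +∞`. -/
def SuperlinearGrowth (φ : ℝ → ℝ≥0∞) : Prop :=
  Tendsto (fun x : ℝ => φ x / ENNReal.ofReal x) atTop (𝓝 ⊤)

/-- The growth function `g_φ x = inf_{x' ≥ x} φ x' / x'` (used for `x ≥ 1`). -/
def growth (φ : ℝ → ℝ≥0∞) (x : ℝ) : ℝ≥0∞ :=
  ⨅ x' ∈ Set.Ici x, φ x' / ENNReal.ofReal x'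

/-- The generalized inverse `inf {x ≥ D | g_φ x ≥ y}` of the growth function
regarded as a function on `[D, ∞)`. -/
def growthInv (φ : ℝ → ℝ≥0∞) (D y : ℝ) : ℝ :=
  sInf {x : ℝ | D ≤ x ∧ ENNReal.ofReal y ≤ growth φ x}

/-- The truncated divergence function: `φ` plus the convex indicator of `[0, L]`. -/
def truncate (φ : ℝ → ℝ≥0∞) (L : ℝ) (x : ℝ) : ℝ≥0∞ :=
  open Classical in φ x + (if x ∈ Set.Icc 0 L then 0 else ⊤)

section Functional

variable {Ω : Type*} [MeasurableSpace Ω]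

/-- The set of probability density functions with respect to `P`. -/
def densities (P : Measure Ω) : Set (Ω → ℝ) :=
  {ζ | Measurable ζ ∧ (∀ ω, 0 ≤ ζ ω) ∧ Integrable ζ P ∧ ∫ ω, ζ ω ∂P = 1}

/-- The divergence ball of radius `τ` around `P`, in terms of densities. -/
def ball (φ : ℝ → ℝ≥0∞) (τ : ℝ) (P : Measure Ω) : Set (Ω → ℝ) :=
  {ζ ∈ densities P | ∫⁻ ω, φ (ζ ω) ∂P ≤ ENNReal.ofReal τ}

/-- The distributionally robust functional `sup_ζ ∫ X ζ dP` over the divergence ball.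
For a probability measure `P`, `τ ≥ 0`, `φ 1 = 0` and a bounded measurable `X`, it is the
supremum of a nonempty bounded set of reals. -/
def robust (φ : ℝ → ℝ≥0∞) (τ : ℝ) (P : Measure Ω) (X : Ω → ℝ) : ℝ :=
  sSup ((fun ζ : Ω → ℝ => ∫ ω, X ω * ζ ω ∂P) '' ball φ τ P)

/-- The empirical distribution of the sample `s 0, …, s (n - 1)`. -/
def empirical {n : ℕ} (s : Fin n → Ω) : Measure Ω :=
  (n : ℝ≥0∞)⁻¹ • ∑ i, Measure.dirac (s i)

/-- The sample average approximation: the robust functional at the empirical distribution. -/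
def saa (φ : ℝ → ℝ≥0∞) (τ : ℝ) (X : Ω → ℝ) {n : ℕ} (s : Fin n → Ω) : ℝ :=
  robust φ τ (empirical s) X

end Functional

/-- The truncation level `L(ε) = g_φ⁻¹ (32 B τ / ε)`. -/
def truncLevel (φ : ℝ → ℝ≥0∞) (D B τ ε : ℝ) : ℝ :=
  growthInv φ D (32 * B * τ / ε)

/-- The lower cutoff `ε / (8 τ)` of the dual multiplier. -/
def lamLower (τ ε : ℝ) : ℝ := ε / (8 * τ)

/-- `L(ε) + 1 + 2 (1 + L(ε)) B / lamLower(ε) + τ`. -/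
def lipConst (φ : ℝ → ℝ≥0∞) (D B τ ε : ℝ) : ℝ :=
  truncLevel φ D B τ ε + 1
    + 2 * (1 + truncLevel φ D B τ ε) * B / lamLower τ ε + τ

/-- `M(ε) = (3 + 2 L(ε)) B`. -/
def boundConst (φ : ℝ → ℝ≥0∞) (D B τ ε : ℝ) : ℝ :=
  (3 + 2 * truncLevel φ D B τ ε) * B

end PhiDivergence

end

/-! ### Bounded divergences and convexity along segments ending at 1. -/

noncomputable section
namespace PhiDivergence

/-- A convex function `ψ : ℝ → [0, ∞]` with `ψ 1 = 0` that is infinite outside `[0, L]`. -/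
structure IsBoundedDivergence (ψ : ℝ → ℝ≥0∞) (L : ℝ) : Prop where
  convex : ConvexOn ℝ≥0 Set.univ ψ
  measurable : Measurable ψ
  map_one : ψ 1 = 0
  one_le : 1 ≤ L
  mem_Icc : ∀ x, ψ x ≠ ⊤ → x ∈ Set.Icc 0 L

/-- Convexity at a point of the segment from `x` to `1`. -/
lemma apply_mix_one_le {φ : ℝ → ℝ≥0∞} (hc : ConvexOn ℝ≥0 Set.univ φ) (h1 : φ 1 = 0)
    {a : ℝ} (ha0 : 0 ≤ a) (ha1 : a ≤ 1) (x : ℝ) :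
    φ (a * x + (1 - a)) ≤ ENNReal.ofReal a * φ x := by
  have h := hc.2 (Set.mem_univ x) (Set.mem_univ (1 : ℝ)) (zero_le (a := a.toNNReal))
    (zero_le (a := (1 - a).toNNReal))
    (by rw [← Real.toNNReal_add ha0 (by linarith)]; simp)
  simp only [h1, smul_zero, add_zero] at h
  have e : a.toNNReal • x + (1 - a).toNNReal • (1 : ℝ) = a * x + (1 - a) := by
    simp [NNReal.smul_def, Real.coe_toNNReal _ ha0,
      Real.coe_toNNReal _ (show 0 ≤ 1 - a by linarith)]
  rw [e] at h
  exact h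

lemma apply_mix_one_le_self {φ : ℝ → ℝ≥0∞} (hc : ConvexOn ℝ≥0 Set.univ φ) (h1 : φ 1 = 0)
    {a : ℝ} (ha0 : 0 ≤ a) (ha1 : a ≤ 1) (x : ℝ) : φ (a * x + (1 - a)) ≤ φ x := by
  refine (apply_mix_one_le hc h1 ha0 ha1 x).trans ?_
  calc ENNReal.ofReal a * φ x ≤ 1 * φ x := by
        gcongr; exact ENNReal.ofReal_le_one.2 ha1
    _ = φ x := one_mul _

/-- Beyond its minimum point 1 a convex function is nondecreasing: `x` lies on the segment from 1 to
`y`, with weight `(x - 1) / (y - 1)` on `y`. -/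
lemma apply_le_of_one_le {φ : ℝ → ℝ≥0∞} (hc : ConvexOn ℝ≥0 Set.univ φ) (h1 : φ 1 = 0)
    {x y : ℝ} (hx : 1 ≤ x) (hxy : x ≤ y) : φ x ≤ φ y := by
  rcases hx.eq_or_lt with rfl | hx
  · simp [h1]
  have hy : 0 < y - 1 := by linarith
  have h := apply_mix_one_le_self hc h1 (a := (x - 1) / (y - 1)) (by apply div_nonneg <;> linarith)
    ((div_le_one hy).2 (by linarith)) y
  convert h using 2
  field_simp
  ring

lemma isBoundedDivergence_truncate {φ : ℝ → ℝ≥0∞} (hφ : IsDivergence φ) {L : ℝ} (hL : 1 ≤ L) :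
    IsBoundedDivergence (truncate φ L) L where
  convex := by
    refine ⟨convex_univ, fun x _ y _ a b _ _ hab => ?_⟩
    have h := hφ.convex.2 (Set.mem_univ x) (Set.mem_univ y) (zero_le (a := a)) (zero_le (a := b)) hab
    unfold truncate
    rw [smul_add, smul_add, add_add_add_comm]
    refine add_le_add h ?_
    -- Zero weights are treated apart because `0 • ⊤ = 0`; for positive weights a point outside `[0,
    -- L]` makes the right-hand side infinite.
    by_cases ha : a = 0
    · subst ha
      obtain rfl : b = 1 := by simpa using hab
      simp
    by_cases hb : b = 0
    · subst hb
      obtain rfl : a = 1 := by simpa using hab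
      simp
    by_cases hx : x ∈ Set.Icc 0 L
    · by_cases hy : y ∈ Set.Icc 0 L
      · have : a • x + b • y ∈ Set.Icc 0 L :=
          (convex_Icc (𝕜 := ℝ) (0 : ℝ) L) hx hy a.2 b.2 (by exact_mod_cast hab)
        simp [this]
      · have : b • (⊤ : ℝ≥0∞) = ⊤ := by
          rw [ENNReal.smul_def, smul_eq_mul, ENNReal.mul_top]; simpa using hb
        simp [hy, this]
    · have : a • (⊤ : ℝ≥0∞) = ⊤ := by
        rw [ENNReal.smul_def, smul_eq_mul, ENNReal.mul_top]; simpa using ha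
      simp [hx, this]
  measurable := by
    unfold truncate
    exact hφ.lsc.measurable.add (Measurable.ite measurableSet_Icc measurable_const measurable_const)
  map_one := by simp [truncate, hφ.map_one, hL]
  one_le := hL
  mem_Icc x hx := by
    by_contra h
    exact hx (by simp only [truncate, if_neg h, add_top])

lemma le_truncate (φ : ℝ → ℝ≥0∞) (L x : ℝ) : φ x ≤ truncate φ L x := le_self_add

lemma truncate_of_mem {φ : ℝ → ℝ≥0∞} {L x : ℝ} (hx : x ∈ Set.Icc 0 L) : truncate φ L x = φ x := by
  simp only [truncate, if_pos hx, add_zero]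

/-! ### The perspective conjugate and the dual integrand. -/

/-- The perspective conjugate `sup_t (u t - l ψ t)` over the effective domain of `ψ`. -/
def conj (ψ : ℝ → ℝ≥0∞) (l u : ℝ) : ℝ :=
  sSup ((fun t => u * t - l * (ψ t).toReal) '' {t | ψ t ≠ ⊤})

/-- The integrand `m + l τ + sup_t ((x - m) t - l ψ t)` of the dual problem. -/
def dualFn (ψ : ℝ → ℝ≥0∞) (τ l m x : ℝ) : ℝ := m + l * τ + conj ψ l (x - m)

section Conj

variable {ψ : ℝ → ℝ≥0∞} {L : ℝ} (hψ : IsBoundedDivergence ψ L)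

include hψ

lemma IsBoundedDivergence.ne_top_one : ψ 1 ≠ ⊤ := by simp [hψ.map_one]

lemma bddAbove_conj {l : ℝ} (hl : 0 ≤ l) (u : ℝ) :
    BddAbove ((fun t => u * t - l * (ψ t).toReal) '' {t | ψ t ≠ ⊤}) := by
  refine ⟨|u| * L, ?_⟩
  rintro _ ⟨t, ht, rfl⟩
  have h := hψ.mem_Icc t ht
  have h1 : u * t ≤ |u| * L :=
    (mul_le_mul_of_nonneg_right (le_abs_self u) h.1).trans
      (mul_le_mul_of_nonneg_left h.2 (abs_nonneg u))
  have h2 : 0 ≤ l * (ψ t).toReal := mul_nonneg hl ENNReal.toReal_nonneg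
  simp only
  linarith

lemma le_conj {l : ℝ} (hl : 0 ≤ l) (u : ℝ) {t : ℝ} (ht : ψ t ≠ ⊤) :
    u * t - l * (ψ t).toReal ≤ conj ψ l u :=
  le_csSup (bddAbove_conj hψ hl u) ⟨t, ht, rfl⟩

lemma conj_le {l u c : ℝ} (h : ∀ t, ψ t ≠ ⊤ → u * t - l * (ψ t).toReal ≤ c) : conj ψ l u ≤ c := by
  refine csSup_le ⟨_, 1, hψ.ne_top_one, rfl⟩ ?_
  rintro _ ⟨t, ht, rfl⟩
  exact h t ht

lemma exists_conj_sub_lt (l u : ℝ) {η : ℝ} (hη : 0 < η) :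
    ∃ t, ψ t ≠ ⊤ ∧ conj ψ l u - η < u * t - l * (ψ t).toReal := by
  obtain ⟨_, ⟨t, ht, rfl⟩, h⟩ := exists_lt_of_lt_csSup
    (s := (fun t => u * t - l * (ψ t).toReal) '' {t | ψ t ≠ ⊤})
    ⟨_, 1, hψ.ne_top_one, rfl⟩ (show conj ψ l u - η < _ from sub_lt_self _ hη)
  exact ⟨t, ht, h⟩

/-- A supremum of affine functions of `u` with slopes in `[0, L]` is `L`-Lipschitz. -/
lemma conj_le_conj_add {l : ℝ} (hl : 0 ≤ l) (u v : ℝ) :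
    conj ψ l u ≤ conj ψ l v + L * |u - v| := by
  refine conj_le hψ fun t ht => ?_
  have h := hψ.mem_Icc t ht
  have h1 := le_conj hψ hl v ht
  have h2 : (u - v) * t ≤ L * |u - v| := by
    calc (u - v) * t ≤ |u - v| * t := mul_le_mul_of_nonneg_right (le_abs_self _) h.1
      _ ≤ |u - v| * L := mul_le_mul_of_nonneg_left h.2 (abs_nonneg _)
      _ = _ := mul_comm _ _
  linarith

lemma measurable_conj {l : ℝ} (hl : 0 ≤ l) : Measurable (conj ψ l) := by
  have : LipschitzWith L.toNNReal (conj ψ l) := by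
    refine LipschitzWith.of_le_add_mul _ fun u v => ?_
    rw [Real.coe_toNNReal _ (by linarith [hψ.one_le]), Real.dist_eq]
    exact conj_le_conj_add hψ hl u v
  exact this.continuous.measurable

lemma measurable_dualFn (τ : ℝ) {l : ℝ} (hl : 0 ≤ l) (m : ℝ) : Measurable (dualFn ψ τ l m) :=
  measurable_const.add ((measurable_conj hψ hl).comp (measurable_id.sub_const m))

/-- Only the upward direction in `l` is controlled: the conjugate decreases in `l`, at a rate that
need not be bounded since `ψ` may be unbounded on its domain. Grid values of `l` are therefore
rounded up. -/
lemma dualFn_le_of_le {τ l l' : ℝ} (hl : 0 ≤ l) (hll : l ≤ l') (m x : ℝ) :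
    dualFn ψ τ l' m x ≤ dualFn ψ τ l m x + (l' - l) * τ := by
  have : conj ψ l' (x - m) ≤ conj ψ l (x - m) := conj_le hψ fun t ht => by
    have := le_conj hψ hl (x - m) ht
    have := mul_le_mul_of_nonneg_right hll (ENNReal.toReal_nonneg (a := ψ t))
    linarith
  unfold dualFn
  linarith

/-- For fixed `t` the slope in `m` is `1 - t`, and `|1 - t| ≤ L` because `t ∈ [0, L]` and `L ≥ 1`.
-/
lemma dualFn_le_add {τ l : ℝ} (hl : 0 ≤ l) (m m' x : ℝ) :
    dualFn ψ τ l m' x ≤ dualFn ψ τ l m x + L * |m' - m| := by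
  have : conj ψ l (x - m') ≤ conj ψ l (x - m) + L * |m' - m| - (m' - m) :=
    conj_le hψ fun t ht => by
      have h := hψ.mem_Icc t ht
      have h1 := le_conj hψ hl (x - m) ht
      have h2 : (m' - m) * (1 - t) ≤ L * |m' - m| := by
        have h3 : |1 - t| ≤ L := abs_le.2 ⟨by linarith [h.2], by linarith [h.1, hψ.one_le]⟩
        calc (m' - m) * (1 - t) ≤ |(m' - m) * (1 - t)| := le_abs_self _
          _ = |1 - t| * |m' - m| := by rw [abs_mul, mul_comm]
          _ ≤ L * |m' - m| := mul_le_mul_of_nonneg_right h3 (abs_nonneg _)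
      linarith
  unfold dualFn
  linarith

/-- On `[-B, B]` the dual integrand takes values in an interval of length `(2 + 2 L) B`. -/
lemma dualFn_mem_Icc {τ l m B x : ℝ} (hl : 0 ≤ l) (hm : m ∈ Set.Icc (-B) B)
    (hx : x ∈ Set.Icc (-B) B) :
    dualFn ψ τ l m x ∈ Set.Icc (m + l * τ - 2 * B) (m + l * τ - 2 * B + (2 + 2 * L) * B) := by
  -- The choice `t = 1` bounds the conjugate below by `x - m`, free of `l`; the upper bound drops
  -- the nonnegative cost, so `l` only shifts the interval.
  have h1 := le_conj hψ hl (x - m) hψ.ne_top_one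
  have hB : 0 ≤ B := by linarith [hm.1, hm.2]
  rw [hψ.map_one] at h1
  simp only [ENNReal.toReal_zero, mul_zero, mul_one, sub_zero] at h1
  have h2 : conj ψ l (x - m) ≤ 2 * B * L := conj_le hψ fun t ht => by
    have h := hψ.mem_Icc t ht
    have h4 : 0 ≤ l * (ψ t).toReal := mul_nonneg hl ENNReal.toReal_nonneg
    have h5 : (x - m) * t ≤ 2 * B * t :=
      mul_le_mul_of_nonneg_right (by linarith [hx.2, hm.1]) h.1
    have h6 : 2 * B * t ≤ 2 * B * L := mul_le_mul_of_nonneg_left h.2 (by linarith)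
    linarith
  unfold dualFn
  constructor
  · linarith [hx.1, hm.2]
  · linarith

end Conj

/-! ### The primal problem: weak duality, repair of densities, truncation. -/

section Primal

variable {Ω : Type*} [MeasurableSpace Ω] {Q : Measure Ω} {X : Ω → ℝ} {B : ℝ}

lemma integrable_mul_density (hX : Measurable X) (hXB : ∀ ω, X ω ∈ Set.Icc (-B) B)
    {ζ : Ω → ℝ} (hζ : Integrable ζ Q) : Integrable (fun ω => X ω * ζ ω) Q :=
  hζ.bdd_mul (c := B) hX.aestronglyMeasurable
    (ae_of_all _ fun ω => abs_le.2 ⟨(hXB ω).1, (hXB ω).2⟩)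

lemma abs_integral_mul_le (hX : Measurable X) (hXB : ∀ ω, X ω ∈ Set.Icc (-B) B)
    {ζ : Ω → ℝ} (hζ : Integrable ζ Q) : |∫ ω, X ω * ζ ω ∂Q| ≤ B * ∫ ω, |ζ ω| ∂Q := by
  rw [← integral_const_mul]
  refine (abs_integral_le_integral_abs).trans (integral_mono (integrable_mul_density hX hXB hζ).abs
    (hζ.abs.const_mul B) fun ω => ?_)
  simp only [abs_mul]
  exact mul_le_mul_of_nonneg_right (abs_le.2 ⟨(hXB ω).1, (hXB ω).2⟩) (abs_nonneg _)

lemma abs_integral_mul_density_le (hX : Measurable X) (hXB : ∀ ω, X ω ∈ Set.Icc (-B) B)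
    {ζ : Ω → ℝ} (hζ : ζ ∈ densities Q) : |∫ ω, X ω * ζ ω ∂Q| ≤ B := by
  have h := abs_integral_mul_le hX hXB hζ.2.2.1
  simp only [fun ω => abs_of_nonneg (hζ.2.1 ω), hζ.2.2.2, mul_one] at h
  exact h

lemma le_robust (hX : Measurable X) (hXB : ∀ ω, X ω ∈ Set.Icc (-B) B) {φ : ℝ → ℝ≥0∞} {τ : ℝ}
    {ζ : Ω → ℝ} (hζ : ζ ∈ ball φ τ Q) : ∫ ω, X ω * ζ ω ∂Q ≤ robust φ τ Q X := by
  refine le_csSup ⟨B, ?_⟩ ⟨ζ, hζ, rfl⟩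
  rintro _ ⟨ξ, hξ, rfl⟩
  exact (abs_le.1 (abs_integral_mul_density_le hX hXB hξ.1)).2

lemma one_mem_ball [IsProbabilityMeasure Q] {φ : ℝ → ℝ≥0∞} (h1 : φ 1 = 0) (τ : ℝ) :
    (fun _ => 1) ∈ ball φ τ Q :=
  ⟨⟨measurable_const, fun _ => zero_le_one, integrable_const _, by simp⟩, by simp [h1]⟩

lemma robust_le [IsProbabilityMeasure Q] {φ : ℝ → ℝ≥0∞} (h1 : φ 1 = 0) {τ c : ℝ}
    (h : ∀ ζ ∈ ball φ τ Q, ∫ ω, X ω * ζ ω ∂Q ≤ c) : robust φ τ Q X ≤ c := by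
  refine csSup_le ⟨_, _, one_mem_ball h1 τ, rfl⟩ ?_
  rintro _ ⟨ζ, hζ, rfl⟩
  exact h ζ hζ

lemma abs_robust_le [IsProbabilityMeasure Q] (hX : Measurable X)
    (hXB : ∀ ω, X ω ∈ Set.Icc (-B) B) {φ : ℝ → ℝ≥0∞} (h1 : φ 1 = 0) (τ : ℝ) :
    |robust φ τ Q X| ≤ B :=
  abs_le.2 ⟨(abs_le.1 (abs_integral_mul_density_le hX hXB (one_mem_ball (Q := Q) h1 τ).1)).1.trans
    (le_robust hX hXB (one_mem_ball h1 τ)),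
    robust_le h1 fun _ hζ => (abs_le.1 (abs_integral_mul_density_le hX hXB hζ.1)).2⟩

lemma robust_truncate_le [IsProbabilityMeasure Q] (hX : Measurable X)
    (hXB : ∀ ω, X ω ∈ Set.Icc (-B) B) {φ : ℝ → ℝ≥0∞} (h1 : φ 1 = 0) {L : ℝ} (hL : 1 ≤ L) (τ : ℝ) :
    robust (truncate φ L) τ Q X ≤ robust φ τ Q X := by
  refine robust_le (by simp [truncate, h1, hL]) fun ζ hζ => le_robust hX hXB ⟨hζ.1, ?_⟩
  exact (lintegral_mono fun ω => le_truncate φ L (ζ ω)).trans hζ.2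

lemma integral_toReal_le_of_mem_ball {φ : ℝ → ℝ≥0∞} {τ : ℝ} (hτ : 0 ≤ τ) {ζ : Ω → ℝ}
    (hm : Measurable φ) (hζ : ζ ∈ ball φ τ Q) :
    Integrable (fun ω => (φ (ζ ω)).toReal) Q ∧ ∫ ω, (φ (ζ ω)).toReal ∂Q ≤ τ ∧
      ∀ᵐ ω ∂Q, φ (ζ ω) ≠ ⊤ := by
  have hmeas : Measurable (fun ω => φ (ζ ω)) := hm.comp hζ.1.1
  have hfin : ∫⁻ ω, φ (ζ ω) ∂Q ≠ ⊤ := (hζ.2.trans_lt ENNReal.ofReal_lt_top).ne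
  have hae : ∀ᵐ ω ∂Q, φ (ζ ω) < ⊤ := ae_lt_top hmeas hfin
  refine ⟨integrable_toReal_of_lintegral_ne_top hmeas.aemeasurable hfin, ?_,
    hae.mono fun _ h => h.ne⟩
  rw [integral_toReal hmeas.aemeasurable hae]
  exact ENNReal.toReal_le_of_le_ofReal hτ hζ.2

lemma integrable_dualFn [IsProbabilityMeasure Q] (hX : Measurable X)
    (hXB : ∀ ω, X ω ∈ Set.Icc (-B) B) {ψ : ℝ → ℝ≥0∞} {L : ℝ} (hψ : IsBoundedDivergence ψ L)
    {τ l : ℝ} (hl : 0 ≤ l) (m : ℝ) : Integrable (fun ω => dualFn ψ τ l m (X ω)) Q := by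
  have hB : ∀ ω, X ω ∈ Set.Icc (-(max B |m|)) (max B |m|) := fun ω =>
    ⟨by linarith [(hXB ω).1, le_max_left B |m|], (hXB ω).2.trans (le_max_left _ _)⟩
  have hm : m ∈ Set.Icc (-(max B |m|)) (max B |m|) :=
    abs_le.1 (le_max_right B |m|)
  exact Integrable.of_mem_Icc _ _ ((measurable_dualFn hψ τ hl m).comp hX).aemeasurable
    (ae_of_all _ fun ω => dualFn_mem_Icc hψ hl hm (hB ω))

lemma integral_lagrangian [IsProbabilityMeasure Q] (hX : Measurable X)
    (hXB : ∀ ω, X ω ∈ Set.Icc (-B) B) {ζ ρ : Ω → ℝ} (hζ : Integrable ζ Q) (hρ : Integrable ρ Q)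
    (τ l m : ℝ) :
    Integrable (fun ω => X ω * ζ ω + m * (1 - ζ ω) + l * (τ - ρ ω)) Q ∧
    ∫ ω, (X ω * ζ ω + m * (1 - ζ ω) + l * (τ - ρ ω)) ∂Q =
      ∫ ω, X ω * ζ ω ∂Q + m * (1 - ∫ ω, ζ ω ∂Q) + l * (τ - ∫ ω, ρ ω ∂Q) := by
  have hXi := integrable_mul_density hX hXB hζ
  have h1 : Integrable (fun ω => m * (1 - ζ ω)) Q := ((integrable_const 1).sub hζ).const_mul m
  have h2 : Integrable (fun ω => l * (τ - ρ ω)) Q := ((integrable_const τ).sub hρ).const_mul l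
  have h3 : Integrable (fun ω => X ω * ζ ω + m * (1 - ζ ω)) Q := hXi.add h1
  refine ⟨h3.add h2, ?_⟩
  rw [integral_add h3 h2, integral_add hXi h1, integral_const_mul, integral_const_mul,
    integral_sub (integrable_const _) hζ, integral_sub (integrable_const _) hρ]
  simp

/-- Weak duality. -/
lemma robust_le_integral_dualFn [IsProbabilityMeasure Q] (hX : Measurable X)
    (hXB : ∀ ω, X ω ∈ Set.Icc (-B) B) {ψ : ℝ → ℝ≥0∞} {L : ℝ} (hψ : IsBoundedDivergence ψ L)
    {τ : ℝ} (hτ : 0 ≤ τ) {l : ℝ} (hl : 0 ≤ l) (m : ℝ) :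
    robust ψ τ Q X ≤ ∫ ω, dualFn ψ τ l m (X ω) ∂Q := by
  refine robust_le hψ.map_one fun ζ hζ => ?_
  obtain ⟨hi, hI, hae⟩ := integral_toReal_le_of_mem_ball hτ hψ.measurable hζ
  have hζi := hζ.1.2.2.1
  obtain ⟨hei, e⟩ := integral_lagrangian hX hXB hζi hi τ l m
  have h0 : 0 ≤ l * (τ - ∫ ω, (ψ (ζ ω)).toReal ∂Q) := mul_nonneg hl (by linarith)
  calc ∫ ω, X ω * ζ ω ∂Q
      ≤ ∫ ω, (X ω * ζ ω + m * (1 - ζ ω) + l * (τ - (ψ (ζ ω)).toReal)) ∂Q := by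
        rw [e, hζ.1.2.2.2]; linarith
    _ ≤ ∫ ω, dualFn ψ τ l m (X ω) ∂Q := by
        refine integral_mono_ae hei (integrable_dualFn hX hXB hψ hl m) ?_
        filter_upwards [hae] with ω hω
        have := le_conj hψ hl (X ω - m) hω
        simp only [dualFn]
        linarith

/-- A function can be moved towards `1` so as to become a density, at a cost controlled by the
defect of its integral and without increasing the divergence. -/
lemma exists_density_of_integral [IsProbabilityMeasure Q] (hX : Measurable X)
    (hXB : ∀ ω, X ω ∈ Set.Icc (-B) B) {φ : ℝ → ℝ≥0∞} (hc : ConvexOn ℝ≥0 Set.univ φ)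
    (h1 : φ 1 = 0) {ζ : Ω → ℝ} (hζm : Measurable ζ) (hζ0 : ∀ ω, 0 ≤ ζ ω) (hζi : Integrable ζ Q) :
    ∃ ξ ∈ densities Q, (∀ ω, φ (ξ ω) ≤ φ (ζ ω)) ∧
      ∫ ω, X ω * ζ ω ∂Q - B * |1 - ∫ ω, ζ ω ∂Q| ≤ ∫ ω, X ω * ξ ω ∂Q := by
  -- Here `κ` is the positive or the negative part of `1 - ζ`, according to the sign of `d = 1 - ∫
  -- ζ`, and `ξ = ζ + (d / K) κ`. Since `|d| ≤ |K|`, each `ξ ω` lies between `ζ ω` and 1. As `κ` has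
  -- constant sign, `∫ |κ| = |K|` and the change in `∫ X ζ` is at most `B |d|`.
  have key : ∀ κ : Ω → ℝ, Measurable κ → Integrable κ Q → (∀ ω, κ ω = 0 ∨ κ ω = 1 - ζ ω) →
      |1 - ∫ ω, ζ ω ∂Q| ≤ |∫ ω, κ ω ∂Q| → ∫ ω, |κ ω| ∂Q = |∫ ω, κ ω ∂Q| →
      0 ≤ (1 - ∫ ω, ζ ω ∂Q) / ∫ ω, κ ω ∂Q → 1 - ∫ ω, ζ ω ∂Q ≠ 0 →
      ∃ ξ ∈ densities Q, (∀ ω, φ (ξ ω) ≤ φ (ζ ω)) ∧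
      ∫ ω, X ω * ζ ω ∂Q - B * |1 - ∫ ω, ζ ω ∂Q| ≤ ∫ ω, X ω * ξ ω ∂Q := by
    intro κ hκm hκi hκ hle habs hθ0 hne
    set K := ∫ ω, κ ω ∂Q with hK
    set d := 1 - ∫ ω, ζ ω ∂Q with hd
    have hK0 : K ≠ 0 := by
      intro h
      rw [h, abs_zero] at hle
      exact hne (abs_nonpos_iff.1 hle)
    have hθ1 : d / K ≤ 1 := by
      refine (le_abs_self _).trans ?_
      rw [abs_div]
      exact div_le_one_of_le₀ hle (abs_nonneg _)
    have hθK : d / K * K = d := div_mul_cancel₀ _ hK0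
    have hmix : ∀ ω, ∃ a : ℝ, 0 ≤ a ∧ a ≤ 1 ∧ ζ ω + d / K * κ ω = a * ζ ω + (1 - a) := by
      intro ω
      rcases hκ ω with h | h
      · exact ⟨1, zero_le_one, le_rfl, by rw [h]; ring⟩
      · exact ⟨1 - d / K, by linarith, by linarith, by rw [h]; ring⟩
    refine ⟨fun ω => ζ ω + d / K * κ ω, ⟨hζm.add (hκm.const_mul _), fun ω => ?_,
      hζi.add (hκi.const_mul _), ?_⟩, fun ω => ?_, ?_⟩
    · obtain ⟨a, ha0, ha1, h⟩ := hmix ω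
      simp only [h]
      have := mul_nonneg ha0 (hζ0 ω)
      linarith
    · rw [integral_add hζi (hκi.const_mul _), integral_const_mul, ← hK, hθK]
      linarith
    · obtain ⟨a, ha0, ha1, h⟩ := hmix ω
      simp only [h]
      exact apply_mix_one_le_self hc h1 ha0 ha1 _
    · have e : ∫ ω, X ω * (ζ ω + d / K * κ ω) ∂Q =
          ∫ ω, X ω * ζ ω ∂Q + d / K * ∫ ω, X ω * κ ω ∂Q := by
        rw [← integral_const_mul, ← integral_add (integrable_mul_density hX hXB hζi)
          ((integrable_mul_density hX hXB hκi).const_mul _)]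
        congr 1
        ext ω
        ring
      rw [e]
      have h2 := (abs_le.1 (abs_integral_mul_le hX hXB hκi)).1
      rw [habs] at h2
      have h3 : d / K * |K| = |d| := by
        rw [← abs_of_nonneg hθ0, ← abs_mul, hθK]
      have h4 := mul_le_mul_of_nonneg_left h2 hθ0
      have h5 : d / K * -(B * |K|) = -(B * |d|) := by rw [← h3]; ring
      linarith
  rcases lt_trichotomy (∫ ω, ζ ω ∂Q) 1 with h | h | h
  · have hi : Integrable (fun ω => max (1 - ζ ω) 0) Q := ((integrable_const 1).sub hζi).pos_part
    have hnn : 0 ≤ ∫ ω, max (1 - ζ ω) 0 ∂Q := integral_nonneg fun ω => le_max_right _ _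
    refine key (fun ω => max (1 - ζ ω) 0) ((measurable_const.sub hζm).max measurable_const) hi
      (fun ω => ?_) ?_ ?_ ?_ (by linarith)
    · rcases le_total (1 - ζ ω) 0 with h | h
      · left; exact max_eq_right h
      · right; exact max_eq_left h
    · rw [abs_of_nonneg hnn, abs_of_nonneg (by linarith)]
      have : 1 - ∫ ω, ζ ω ∂Q = ∫ ω, (1 - ζ ω) ∂Q := by
        rw [integral_sub (integrable_const _) hζi]; simp
      rw [this]
      exact integral_mono ((integrable_const 1).sub hζi) hi fun ω => le_max_left _ _
    · rw [abs_of_nonneg hnn]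
      exact integral_congr_ae (ae_of_all _ fun ω => abs_of_nonneg (le_max_right _ _))
    · exact div_nonneg (by linarith) hnn
  · refine ⟨ζ, ⟨hζm, hζ0, hζi, h⟩, fun _ => le_rfl, ?_⟩
    simp [h]
  · have hi : Integrable (fun ω => min (1 - ζ ω) 0) Q := by
      have := (hζi.sub (integrable_const 1)).pos_part.neg
      refine this.congr (ae_of_all _ fun ω => ?_)
      simp only [Pi.neg_apply, Pi.sub_apply]
      rw [← min_neg_neg, neg_sub, neg_zero]
    have hnn : ∫ ω, min (1 - ζ ω) 0 ∂Q ≤ 0 := integral_nonpos fun ω => min_le_right _ _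
    refine key (fun ω => min (1 - ζ ω) 0) ((measurable_const.sub hζm).min measurable_const) hi
      (fun ω => ?_) ?_ ?_ ?_ (by linarith)
    · rcases le_total (1 - ζ ω) 0 with h | h
      · right; exact min_eq_left h
      · left; exact min_eq_right h
    · rw [abs_of_nonpos hnn, abs_of_nonpos (by linarith)]
      have : 1 - ∫ ω, ζ ω ∂Q = ∫ ω, (1 - ζ ω) ∂Q := by
        rw [integral_sub (integrable_const _) hζi]; simp
      rw [this]
      exact neg_le_neg (integral_mono hi ((integrable_const 1).sub hζi) fun ω => min_le_left _ _)
    · rw [abs_of_nonpos hnn, ← integral_neg]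
      exact integral_congr_ae (ae_of_all _ fun ω => abs_of_nonpos (min_le_right _ _))
    · exact div_nonneg_of_nonpos (by linarith) hnn

/-- Truncating a divergence with growth at least `y` beyond `L` costs at most `2 B τ / y`. -/
lemma robust_le_robust_truncate [IsProbabilityMeasure Q] (hX : Measurable X)
    (hXB : ∀ ω, X ω ∈ Set.Icc (-B) B) (hB : 0 ≤ B) {φ : ℝ → ℝ≥0∞} (hφ : IsDivergence φ)
    {L y τ : ℝ} (hL : 1 ≤ L) (hτ : 0 ≤ τ) (hy : 0 < y)
    (hg : ∀ x, L < x → ENNReal.ofReal (y * x) ≤ φ x) :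
    robust φ τ Q X ≤ robust (truncate φ L) τ Q X + 2 * B * τ / y := by
  refine robust_le hφ.map_one fun ζ hζ => ?_
  obtain ⟨hi, hI, hae⟩ := integral_toReal_le_of_mem_ball hτ hφ.lsc.measurable hζ
  have hζi := hζ.1.2.2.1
  have hmi : Integrable (fun ω => min (ζ ω) L) Q := hζi.inf (integrable_const L)
  -- The lost mass costs `B τ / y` twice: once by capping, once by restoring total mass 1.
  have hdef : ∫ ω, (ζ ω - min (ζ ω) L) ∂Q ≤ τ / y := by
    calc ∫ ω, (ζ ω - min (ζ ω) L) ∂Q ≤ ∫ ω, (φ (ζ ω)).toReal / y ∂Q := by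
          refine integral_mono_ae (hζi.sub hmi) (hi.div_const y) ?_
          filter_upwards [hae] with ω hω
          rcases le_or_gt (ζ ω) L with h | h
          · rw [min_eq_left h, sub_self]
            exact div_nonneg ENNReal.toReal_nonneg hy.le
          · rw [min_eq_right h.le, le_div_iff₀ hy]
            have h2 := (ENNReal.ofReal_le_iff_le_toReal hω).1 (hg _ h)
            nlinarith
      _ ≤ τ / y := by
          rw [integral_div]
          gcongr
  have hdef0 : 0 ≤ ∫ ω, (ζ ω - min (ζ ω) L) ∂Q :=
    integral_nonneg fun ω => sub_nonneg.2 (min_le_left _ _)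
  have hone : ∫ ω, (ζ ω - min (ζ ω) L) ∂Q = 1 - ∫ ω, min (ζ ω) L ∂Q := by
    rw [integral_sub hζi hmi, hζ.1.2.2.2]
  have hψ := isBoundedDivergence_truncate hφ hL
  obtain ⟨ξ, hξ, hξφ, hξX⟩ := exists_density_of_integral hX hXB hψ.convex hψ.map_one
    (hζ.1.1.min measurable_const) (fun ω => le_min (hζ.1.2.1 ω) (by linarith)) hmi
  rw [← hone, abs_of_nonneg hdef0] at hξX
  have hball : ξ ∈ ball (truncate φ L) τ Q := by
    refine ⟨hξ, (lintegral_mono fun ω => (hξφ ω).trans ?_).trans hζ.2⟩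
    rw [truncate_of_mem ⟨le_min (hζ.1.2.1 ω) (by linarith), min_le_right _ _⟩]
    rcases le_total (ζ ω) L with h | h
    · rw [min_eq_left h]
    · rw [min_eq_right h]
      exact apply_le_of_one_le hφ.convex hφ.map_one hL h
  have h2 : ∫ ω, X ω * ζ ω ∂Q - ∫ ω, X ω * min (ζ ω) L ∂Q
      ≤ B * ∫ ω, (ζ ω - min (ζ ω) L) ∂Q := by
    rw [← integral_sub (integrable_mul_density hX hXB hζi) (integrable_mul_density hX hXB hmi),
      ← integral_const_mul]
    refine integral_mono ((integrable_mul_density hX hXB hζi).sub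
      (integrable_mul_density hX hXB hmi)) ((hζi.sub hmi).const_mul B) fun ω => ?_
    have : 0 ≤ ζ ω - min (ζ ω) L := sub_nonneg.2 (min_le_left _ _)
    simp only [← mul_sub]
    exact mul_le_mul_of_nonneg_right (hXB ω).2 this
  have h3 := le_robust hX hXB hball
  have h4 := mul_le_mul_of_nonneg_left hdef hB
  have h5 : 2 * B * τ / y = B * (τ / y) + B * (τ / y) := by ring
  linarith

end Primal

/-! ### Strong duality with bounded multipliers. -/

section Duality

variable {Ω : Type*} [MeasurableSpace Ω] {Q : Measure Ω} {X : Ω → ℝ} {B : ℝ}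
  {ψ : ℝ → ℝ≥0∞} {L : ℝ}

/-- Nonnegative functions of finite divergence, not necessarily of integral `1`. -/
def finiteCost (ψ : ℝ → ℝ≥0∞) (Q : Measure Ω) : Set (Ω → ℝ) :=
  {ζ | Measurable ζ ∧ (∀ ω, ψ (ζ ω) ≠ ⊤) ∧ Integrable (fun ω => (ψ (ζ ω)).toReal) Q}

lemma integrable_of_mem_finiteCost [IsProbabilityMeasure Q] (hψ : IsBoundedDivergence ψ L)
    {ζ : Ω → ℝ} (hζ : ζ ∈ finiteCost ψ Q) : Integrable ζ Q :=
  Integrable.of_mem_Icc 0 L hζ.1.aemeasurable (ae_of_all _ fun ω => hψ.mem_Icc _ (hζ.2.1 ω))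

/-- Exact penalization of both constraints defining the divergence ball. -/
lemma penalized_le_robust [IsProbabilityMeasure Q] (hX : Measurable X)
    (hXB : ∀ ω, X ω ∈ Set.Icc (-B) B) (hB : 0 ≤ B) (hψ : IsBoundedDivergence ψ L)
    {τ : ℝ} (hτ : 0 < τ) {ζ : Ω → ℝ} (hζ : ζ ∈ finiteCost ψ Q) :
    ∫ ω, X ω * ζ ω ∂Q - B * |1 - ∫ ω, ζ ω ∂Q|
      - 2 * B / τ * max (∫ ω, (ψ (ζ ω)).toReal ∂Q - τ) 0 ≤ robust ψ τ Q X := by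
  obtain ⟨ξ, hξ, hξψ, hξX⟩ := exists_density_of_integral hX hXB hψ.convex hψ.map_one hζ.1
    (fun ω => (hψ.mem_Icc _ (hζ.2.1 ω)).1) (integrable_of_mem_finiteCost hψ hζ)
  set I := ∫ ω, (ψ (ζ ω)).toReal ∂Q with hI
  have hlin : ∫⁻ ω, ψ (ξ ω) ∂Q ≤ ENNReal.ofReal I := by
    rw [hI, ofReal_integral_eq_lintegral_ofReal hζ.2.2 (ae_of_all _ fun _ => ENNReal.toReal_nonneg)]
    refine lintegral_mono fun ω => ?_
    rw [ENNReal.ofReal_toReal (hζ.2.1 ω)]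
    exact hξψ ω
  rcases le_or_gt I τ with h | h
  · rw [max_eq_right (by linarith), mul_zero, sub_zero]
    exact hξX.trans (le_robust hX hXB ⟨hξ, hlin.trans (ENNReal.ofReal_le_ofReal h)⟩)
  · have hI0 : 0 < I := hτ.trans h
    have ha0 : 0 ≤ τ / I := (div_pos hτ hI0).le
    have ha1 : τ / I ≤ 1 := (div_le_one hI0).2 h.le
    -- Mixing with the constant density 1 scales the divergence by `τ / I`, back to at most `τ`, and
    -- costs at most `2 B (1 - τ / I) ≤ 2 B (I - τ) / τ`.
    have hball : (fun ω => τ / I * ξ ω + (1 - τ / I)) ∈ ball ψ τ Q := by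
      refine ⟨⟨(hξ.1.const_mul _).add_const _, fun ω => ?_,
        (hξ.2.2.1.const_mul _).add (integrable_const _), ?_⟩, ?_⟩
      · have := mul_nonneg ha0 (hξ.2.1 ω)
        simp only
        linarith
      · rw [integral_add (hξ.2.2.1.const_mul _) (integrable_const _), integral_const_mul,
          hξ.2.2.2]
        simp
      · calc ∫⁻ ω, ψ (τ / I * ξ ω + (1 - τ / I)) ∂Q
            ≤ ∫⁻ ω, ENNReal.ofReal (τ / I) * ψ (ξ ω) ∂Q :=
              lintegral_mono fun ω => apply_mix_one_le hψ.convex hψ.map_one ha0 ha1 _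
          _ = ENNReal.ofReal (τ / I) * ∫⁻ ω, ψ (ξ ω) ∂Q :=
              lintegral_const_mul _ (hψ.measurable.comp hξ.1)
          _ ≤ ENNReal.ofReal (τ / I) * ENNReal.ofReal I := by gcongr
          _ = ENNReal.ofReal τ := by
              rw [← ENNReal.ofReal_mul ha0, div_mul_cancel₀ _ hI0.ne']
    have h1 := le_robust hX hXB hball
    have hXi := integrable_mul_density hX hXB hξ.2.2.1
    have hXi1 : Integrable X Q := Integrable.of_mem_Icc _ _ hX.aemeasurable (ae_of_all _ hXB)
    have e : ∫ ω, X ω * (τ / I * ξ ω + (1 - τ / I)) ∂Q =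
        τ / I * ∫ ω, X ω * ξ ω ∂Q + (1 - τ / I) * ∫ ω, X ω ∂Q := by
      rw [← integral_const_mul, ← integral_const_mul,
        ← integral_add (hXi.const_mul _) (hXi1.const_mul _)]
      congr 1
      ext ω
      ring
    rw [e] at h1
    have h2 := (abs_le.1 (abs_integral_mul_density_le hX hXB hξ)).2
    have h3 : -B ≤ ∫ ω, X ω ∂Q := by
      have := (abs_le.1 (abs_integral_mul_density_le hX hXB
        (one_mem_ball (Q := Q) hψ.map_one τ).1)).1
      simpa using this
    rw [max_eq_left (by linarith)]
    have h4 : 1 - τ / I ≤ (I - τ) / τ := by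
      rw [sub_div, div_self hτ.ne']
      have h6 : τ / I * (I / τ) = 1 := by field_simp
      nlinarith [sq_nonneg (I / τ - 1), div_pos hI0 hτ, div_pos hτ hI0,
        (one_le_div hτ).2 h.le, ha1]
    have h5 : 2 * B / τ * (I - τ) = 2 * B * ((I - τ) / τ) := by ring
    have h7 := mul_le_mul_of_nonneg_left h4 (show 0 ≤ 2 * B by linarith)
    have h8 := mul_le_mul_of_nonneg_left h2 (show 0 ≤ 1 - τ / I by linarith)
    have h9 := mul_le_mul_of_nonneg_left h3 (show 0 ≤ 1 - τ / I by linarith)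
    rw [h5]
    linarith

/-- The values `(∫ X ζ, 1 - ∫ ζ, c)` with `c ≤ τ - ∫ ψ ζ`. -/
def attainable (ψ : ℝ → ℝ≥0∞) (τ : ℝ) (Q : Measure Ω) (X : Ω → ℝ) : Set (ℝ × ℝ × ℝ) :=
  {y | ∃ ζ ∈ finiteCost ψ Q, y.1 = ∫ ω, X ω * ζ ω ∂Q ∧ y.2.1 = 1 - ∫ ω, ζ ω ∂Q ∧
    y.2.2 ≤ τ - ∫ ω, (ψ (ζ ω)).toReal ∂Q}

/-- The inequality in the third coordinate is what makes the set convex: mixing two functions only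
bounds the cost from above. -/
lemma convex_attainable [IsProbabilityMeasure Q] (hX : Measurable X)
    (hXB : ∀ ω, X ω ∈ Set.Icc (-B) B) (hψ : IsBoundedDivergence ψ L) (τ : ℝ) :
    Convex ℝ (attainable ψ τ Q X) := by
  rintro y ⟨ζ, hζ, h1, h2, h3⟩ y' ⟨ζ', hζ', h1', h2', h3'⟩ a b ha hb hab
  have hle : ∀ ω, ψ (a * ζ ω + b * ζ' ω) ≤
      ENNReal.ofReal a * ψ (ζ ω) + ENNReal.ofReal b * ψ (ζ' ω) := by
    intro ω
    have h := hψ.convex.2 (Set.mem_univ (ζ ω)) (Set.mem_univ (ζ' ω)) (zero_le (a := a.toNNReal))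
      (zero_le (a := b.toNNReal)) (by rw [← Real.toNNReal_add ha hb, hab]; simp)
    have e : a.toNNReal • ζ ω + b.toNNReal • ζ' ω = a * ζ ω + b * ζ' ω := by
      simp [NNReal.smul_def, Real.coe_toNNReal _ ha, Real.coe_toNNReal _ hb]
    rw [e] at h
    exact h
  have hne : ∀ ω, ENNReal.ofReal a * ψ (ζ ω) + ENNReal.ofReal b * ψ (ζ' ω) ≠ ⊤ := fun ω =>
    ENNReal.add_ne_top.2 ⟨ENNReal.mul_ne_top ENNReal.ofReal_ne_top (hζ.2.1 ω),
      ENNReal.mul_ne_top ENNReal.ofReal_ne_top (hζ'.2.1 ω)⟩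
  have hle' : ∀ ω, (ψ (a * ζ ω + b * ζ' ω)).toReal ≤
      a * (ψ (ζ ω)).toReal + b * (ψ (ζ' ω)).toReal := by
    intro ω
    have h := ENNReal.toReal_mono (hne ω) (hle ω)
    rwa [ENNReal.toReal_add (ENNReal.mul_ne_top ENNReal.ofReal_ne_top (hζ.2.1 ω))
      (ENNReal.mul_ne_top ENNReal.ofReal_ne_top (hζ'.2.1 ω)), ENNReal.toReal_mul,
      ENNReal.toReal_mul, ENNReal.toReal_ofReal ha, ENNReal.toReal_ofReal hb] at h
  have hi := integrable_of_mem_finiteCost hψ hζ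
  have hi' := integrable_of_mem_finiteCost hψ hζ'
  have hm : Measurable (fun ω => a * ζ ω + b * ζ' ω) :=
    (hζ.1.const_mul a).add (hζ'.1.const_mul b)
  have hci : Integrable (fun ω => a * (ψ (ζ ω)).toReal + b * (ψ (ζ' ω)).toReal) Q :=
    (hζ.2.2.const_mul a).add (hζ'.2.2.const_mul b)
  have hpi : Integrable (fun ω => (ψ (a * ζ ω + b * ζ' ω)).toReal) Q :=
    hci.mono' (hψ.measurable.comp hm).ennreal_toReal.aestronglyMeasurable
      (ae_of_all _ fun ω => by
        rw [Real.norm_of_nonneg ENNReal.toReal_nonneg]; exact hle' ω)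
  refine ⟨fun ω => a * ζ ω + b * ζ' ω, ⟨hm, fun ω => ne_top_of_le_ne_top (hne ω) (hle ω), hpi⟩,
    ?_, ?_, ?_⟩
  · simp only [Prod.fst_add, Prod.smul_fst, smul_eq_mul, h1, h1']
    rw [← integral_const_mul, ← integral_const_mul,
      ← integral_add ((integrable_mul_density hX hXB hi).const_mul _)
        ((integrable_mul_density hX hXB hi').const_mul _)]
    congr 1
    ext ω
    ring
  · simp only [Prod.fst_add, Prod.snd_add, Prod.smul_fst, Prod.smul_snd, smul_eq_mul, h2, h2']
    rw [integral_add (hi.const_mul _) (hi'.const_mul _), integral_const_mul, integral_const_mul]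
    linear_combination hab
  · simp only [Prod.snd_add, Prod.smul_snd, smul_eq_mul]
    have h := integral_mono hpi hci hle'
    rw [integral_add (hζ.2.2.const_mul _) (hζ'.2.2.const_mul _), integral_const_mul,
      integral_const_mul] at h
    have g1 := mul_le_mul_of_nonneg_left h3 ha
    have g2 := mul_le_mul_of_nonneg_left h3' hb
    have g3 : (a + b) * τ = τ := by rw [hab, one_mul]
    linarith

/-- Minimax for a bilinear payoff: a compact convex set of multipliers against a convex set. -/
lemma exists_forall_le_of_forall_exists_le {K : Set (ℝ × ℝ)} (hK : IsCompact K)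
    (hKc : Convex ℝ K) (hKn : K.Nonempty) {Y : Set (ℝ × ℝ × ℝ)} (hY : Convex ℝ Y) {r : ℝ}
    (h : ∀ y ∈ Y, ∃ x ∈ K, y.1 + x.2 * y.2.1 + x.1 * y.2.2 ≤ r) :
    ∃ x ∈ K, ∀ y ∈ Y, y.1 + x.2 * y.2.1 + x.1 * y.2.2 ≤ r := by
  by_contra! hcon
  set f : ℝ × ℝ → ℝ × ℝ × ℝ → ℝ := fun x y => y.1 + x.2 * y.2.1 + x.1 * y.2.2 with hf
  choose! g hgY hg using hcon
  -- Compactness of `K` leaves finitely many points of `Y` whose maximal payoff exceeds `r` on all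
  -- of `K`. The finite step of Sion's theorem merges them into one point of `Y`, so no compactness
  -- of `Y` is needed.
  obtain ⟨t, htK, hcover⟩ := hK.elim_nhds_subcover (fun x => {z | r < f z (g x)}) fun x hx =>
    (isOpen_lt continuous_const (by fun_prop)).mem_nhds (hg x hx)
  have hconv : ∀ y, QuasiconvexOn ℝ K fun x => f x y := fun y =>
    ConvexOn.quasiconvexOn ⟨hKc, fun x _ z _ a b _ _ hab => by
      simp only [hf, Prod.fst_add, Prod.snd_add, Prod.smul_fst, Prod.smul_snd, smul_eq_mul]
      apply le_of_eq
      linear_combination (-y.1) * hab⟩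
  have hconc : ∀ x, QuasiconcaveOn ℝ Y fun y => f x y := fun x =>
    ConcaveOn.quasiconcaveOn ⟨hY, fun y _ z _ a b _ _ hab => by
      simp only [hf, Prod.fst_add, Prod.snd_add, Prod.smul_fst, Prod.smul_snd, smul_eq_mul]
      apply le_of_eq
      ring⟩
  obtain ⟨y, hyY, hy⟩ := Sion.exists_lt_iInf_of_lt_iInf_of_finite (X := K) (Y := Y) (f := f)
    (ne_X := hKn) (kX := hK) (cX := hKc) (cY := hY)
    (hfx := fun x _ => (by fun_prop : Continuous fun y => f x y).upperSemicontinuous.upperSemicontinuousOn _)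
    (hfx' := fun x _ => hconc x)
    (hfy := fun y _ => (by fun_prop : Continuous fun x => f x y).lowerSemicontinuous.lowerSemicontinuousOn _)
    (hfy' := fun y _ => hconv y)
    (s := g '' t) (t.finite_toSet.image g)
    (by rintro _ ⟨x, hx, rfl⟩; exact hgY x (htK x hx)) (t := r)
    (fun x hx => by
      obtain ⟨z, hz, hxz⟩ := Set.mem_iUnion₂.1 (hcover hx)
      exact ⟨g z, ⟨z, hz, rfl⟩, hxz⟩)
  obtain ⟨x, hx, hxy⟩ := h y hyY
  exact absurd (hy x hx) (not_lt.2 hxy)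

/-- Exchange of supremum and integral in the dual problem. -/
lemma integral_dualFn_le [IsProbabilityMeasure Q] (hX : Measurable X)
    (hXB : ∀ ω, X ω ∈ Set.Icc (-B) B) (hψ : IsBoundedDivergence ψ L) {τ l m c : ℝ} (hl : 0 ≤ l)
    (h : ∀ ζ ∈ finiteCost ψ Q, ∫ ω, X ω * ζ ω ∂Q + m * (1 - ∫ ω, ζ ω ∂Q)
      + l * (τ - ∫ ω, (ψ (ζ ω)).toReal ∂Q) ≤ c) :
    ∫ ω, dualFn ψ τ l m (X ω) ∂Q ≤ c := by
  have key : ∀ η : ℝ, 0 < η → ∫ ω, dualFn ψ τ l m (X ω) ∂Q ≤ c + (1 + 2 * L) * η := by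
    intro η hη
    -- Rounding `X` down to a multiple of `η` reduces the near-maximizer to one choice per integer,
    -- so measurability is automatic. The error is `η` for near-optimality and `L η` for each of the
    -- two replacements of `X` by its rounding.
    choose t htop ht using fun k : ℤ => exists_conj_sub_lt hψ l (η * k - m) hη
    set k : Ω → ℤ := fun ω => ⌊X ω / η⌋ with hk
    have hkm : Measurable k := (hX.div_const η).floor
    set ζ : Ω → ℝ := fun ω => t (k ω) with hζ
    have hζm : Measurable ζ := (measurable_from_top (f := t)).comp hkm
    have hkX : ∀ ω, |X ω - η * k ω| ≤ η := by
      intro ω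
      have h1 := Int.floor_le (X ω / η)
      have h2 := Int.lt_floor_add_one (X ω / η)
      rw [le_div_iff₀ hη] at h1
      rw [div_lt_iff₀ hη] at h2
      rw [abs_le]
      constructor
      · simp only [hk]; linarith
      · simp only [hk]; linarith
    have hkb : ∀ ω, k ω ∈ Finset.Icc ⌊-B / η⌋ ⌊B / η⌋ := fun ω =>
      Finset.mem_Icc.2 ⟨Int.floor_le_floor (div_le_div_of_nonneg_right (hXB ω).1 hη.le),
        Int.floor_le_floor (div_le_div_of_nonneg_right (hXB ω).2 hη.le)⟩
    have hci : Integrable (fun ω => (ψ (ζ ω)).toReal) Q := by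
      refine Integrable.of_mem_Icc 0 (∑ j ∈ Finset.Icc ⌊-B / η⌋ ⌊B / η⌋, (ψ (t j)).toReal)
        (hψ.measurable.comp hζm).ennreal_toReal.aemeasurable (ae_of_all _ fun ω =>
          ⟨ENNReal.toReal_nonneg, ?_⟩)
      exact Finset.single_le_sum (f := fun j => (ψ (t j)).toReal)
        (fun _ _ => ENNReal.toReal_nonneg) (hkb ω)
    have hmem : ζ ∈ finiteCost ψ Q := ⟨hζm, fun ω => htop _, hci⟩
    have hζi := integrable_of_mem_finiteCost hψ hmem
    obtain ⟨hei, he⟩ := integral_lagrangian hX hXB hζi hci τ l m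
    have h0 := h ζ hmem
    rw [← he] at h0
    have h1 : ∫ ω, dualFn ψ τ l m (X ω) ∂Q ≤
        ∫ ω, (X ω * ζ ω + m * (1 - ζ ω) + l * (τ - (ψ (ζ ω)).toReal) + (1 + 2 * L) * η) ∂Q := by
      refine integral_mono (integrable_dualFn hX hXB hψ hl m) (hei.add (integrable_const _))
        fun ω => ?_
      have g1 := conj_le_conj_add hψ hl (X ω - m) (η * k ω - m)
      have g2 := ht (k ω)
      have hL := hψ.one_le
      have g3 := hψ.mem_Icc _ (htop (k ω))
      have g4 := mul_le_mul_of_nonneg_left (hkX ω) (show 0 ≤ L by linarith)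
      have g5 : -(L * η) ≤ (X ω - η * k ω) * t (k ω) := by
        have h5 : |(X ω - η * k ω) * t (k ω)| ≤ η * L := by
          rw [abs_mul, abs_of_nonneg g3.1]
          exact mul_le_mul (hkX ω) g3.2 g3.1 hη.le
        linarith [(abs_le.1 h5).1]
      have e : X ω - m - (η * k ω - m) = X ω - η * k ω := by ring
      rw [e] at g1
      simp only [dualFn, hζ]
      linarith
    rw [integral_add hei (integrable_const _)] at h1
    simp only [integral_const, probReal_univ, one_smul] at h1
    linarith
  refine le_of_forall_pos_le_add fun δ hδ => ?_
  have hL := hψ.one_le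
  have := key (δ / (1 + 2 * L)) (by positivity)
  rwa [mul_div_cancel₀ _ (by positivity)] at this

/-- Strong duality, with multipliers in an explicit rectangle. -/
lemma exists_integral_dualFn_le_robust [IsProbabilityMeasure Q] (hX : Measurable X)
    (hXB : ∀ ω, X ω ∈ Set.Icc (-B) B) (hB : 0 ≤ B) (hψ : IsBoundedDivergence ψ L)
    {τ : ℝ} (hτ : 0 < τ) :
    ∃ l ∈ Set.Icc 0 (2 * B / τ), ∃ m ∈ Set.Icc (-B) B,
      ∫ ω, dualFn ψ τ l m (X ω) ∂Q ≤ robust ψ τ Q X := by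
  have hΛ : 0 ≤ 2 * B / τ := by positivity
  obtain ⟨x, hx, h⟩ := exists_forall_le_of_forall_exists_le
    (K := Set.Icc 0 (2 * B / τ) ×ˢ Set.Icc (-B) B) (isCompact_Icc.prod isCompact_Icc)
    ((convex_Icc _ _).prod (convex_Icc _ _)) ⟨(0, B), ⟨le_rfl, hΛ⟩, by linarith, le_rfl⟩
    (convex_attainable (Q := Q) hX hXB hψ τ) (r := robust ψ τ Q X) (by
      rintro ⟨y1, y2, y3⟩ ⟨ζ, hζ, h1, h2, h3⟩
      have hp := penalized_le_robust hX hXB hB hψ hτ hζ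
      simp only at h1 h2 h3
      rw [← h1, ← h2] at hp
      -- The extreme `m` of sign opposite to `y2` realizes the mass penalty; `l` is 0 or `2 B / τ`
      -- according to the sign of the slack `y3`.
      obtain ⟨m, hm, hm'⟩ : ∃ m ∈ Set.Icc (-B) B, m * y2 = -(B * |y2|) := by
        rcases le_total 0 y2 with h | h
        · exact ⟨-B, ⟨le_rfl, by linarith⟩, by rw [abs_of_nonneg h]; ring⟩
        · exact ⟨B, ⟨by linarith, le_rfl⟩, by rw [abs_of_nonpos h]; ring⟩
      rcases le_total 0 y3 with h | h
      · refine ⟨(0, m), ⟨⟨le_rfl, hΛ⟩, hm⟩, ?_⟩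
        rw [max_eq_right (by linarith)] at hp
        simp only
        linarith
      · refine ⟨(2 * B / τ, m), ⟨⟨hΛ, le_rfl⟩, hm⟩, ?_⟩
        have : max (∫ ω, (ψ (ζ ω)).toReal ∂Q - τ) 0 ≤ -y3 :=
          max_le (by linarith) (by linarith)
        have := mul_le_mul_of_nonneg_left this hΛ
        simp only
        linarith)
  refine ⟨x.1, hx.1, x.2, hx.2, integral_dualFn_le hX hXB hψ hx.1.1 fun ζ hζ => ?_⟩
  exact h (_, _, _) ⟨ζ, hζ, rfl, rfl, le_rfl⟩

/-- Strong duality up to `2 η`, with multipliers in a finite grid. -/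
lemma exists_grid_integral_dualFn_le [IsProbabilityMeasure Q] (hX : Measurable X)
    (hXB : ∀ ω, X ω ∈ Set.Icc (-B) B) (hB : 0 ≤ B) (hψ : IsBoundedDivergence ψ L)
    {τ : ℝ} (hτ : 0 < τ) {η : ℝ} (hη : 0 < η) :
    ∃ i ≤ ⌈2 * B / η⌉₊, ∃ j ≤ ⌊2 * B * L / η⌋₊,
      ∫ ω, dualFn ψ τ (i * (η / τ)) (-B + j * (η / L)) (X ω) ∂Q ≤ robust ψ τ Q X + 2 * η := by
  obtain ⟨l, hl, m, hm, h⟩ := exists_integral_dualFn_le_robust (Q := Q) hX hXB hB hψ hτ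
  have hL : 0 < L := by linarith [hψ.one_le]
  have hητ : 0 < η / τ := div_pos hη hτ
  have hηL : 0 < η / L := div_pos hη hL
  -- Rounding `l` up may leave the rectangle, harmlessly; rounding `m` down keeps it at least `-B`.
  -- Each rounding costs at most `η`.
  refine ⟨⌈l / (η / τ)⌉₊, Nat.ceil_mono ?_, ⌊(m + B) / (η / L)⌋₊, Nat.floor_mono ?_, ?_⟩
  · have e : 2 * B / η = 2 * B / τ / (η / τ) := by field_simp
    rw [e]
    exact div_le_div_of_nonneg_right hl.2 hητ.le
  · have e : 2 * B * L / η = 2 * B / (η / L) := by field_simp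
    rw [e]
    exact div_le_div_of_nonneg_right (by linarith [hm.2]) hηL.le
  · set l' := (⌈l / (η / τ)⌉₊ : ℝ) * (η / τ) with hl'
    set m' := -B + (⌊(m + B) / (η / L)⌋₊ : ℝ) * (η / L) with hm'
    have h1 : l ≤ l' := by
      rw [hl', ← div_le_iff₀ hητ]
      exact Nat.le_ceil _
    have h2 : l' - l ≤ η / τ := by
      have := (Nat.ceil_lt_add_one (div_nonneg hl.1 hητ.le)).le
      have := mul_le_mul_of_nonneg_right this hητ.le
      rw [add_mul, div_mul_cancel₀ _ hητ.ne'] at this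
      linarith
    have h2' : (l' - l) * τ ≤ η := by
      have := mul_le_mul_of_nonneg_right h2 hτ.le
      rwa [div_mul_cancel₀ _ hτ.ne'] at this
    have h3 : |m' - m| ≤ η / L := by
      have g1 := Nat.floor_le (div_nonneg (by linarith [hm.1] : 0 ≤ m + B) hηL.le)
      have g2 := (Nat.lt_floor_add_one ((m + B) / (η / L))).le
      rw [le_div_iff₀ hηL] at g1
      rw [div_le_iff₀ hηL] at g2
      rw [abs_le]
      constructor <;> linarith
    have h3' : L * |m' - m| ≤ η := by
      have := mul_le_mul_of_nonneg_left h3 hL.le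
      rwa [mul_div_cancel₀ _ hL.ne'] at this
    calc ∫ ω, dualFn ψ τ l' m' (X ω) ∂Q
        ≤ ∫ ω, (dualFn ψ τ l m (X ω) + 2 * η) ∂Q := by
          refine integral_mono (integrable_dualFn hX hXB hψ (hl.1.trans h1) m')
            ((integrable_dualFn hX hXB hψ hl.1 m).add (integrable_const _)) fun ω => ?_
          have g1 := dualFn_le_of_le hψ (τ := τ) hl.1 h1 m' (X ω)
          have g2 := dualFn_le_add hψ (τ := τ) hl.1 m m' (X ω)
          simp only
          linarith
      _ ≤ robust ψ τ Q X + 2 * η := by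
          rw [integral_add (integrable_dualFn hX hXB hψ hl.1 m) (integrable_const _)]
          simp only [integral_const, probReal_univ, one_smul]
          linarith

end Duality

/-! ### Empirical measures: concentration, measurability and bias. -/

section Sampling

variable {Ω : Type*} [MeasurableSpace Ω] {P : Measure Ω} [IsProbabilityMeasure P]
  {X : Ω → ℝ} {B : ℝ} {ψ : ℝ → ℝ≥0∞} {L : ℝ} {n : ℕ}

omit [IsProbabilityMeasure P] in
lemma isProbabilityMeasure_empirical (hn : 0 < n) (s : Fin n → Ω) :
    IsProbabilityMeasure (empirical s) := ⟨by
  simp only [empirical, Measure.smul_apply, Measure.finsetSum_apply, measure_univ, Finset.sum_const,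
    Finset.card_univ, Fintype.card_fin, smul_eq_mul, nsmul_eq_mul, mul_one]
  exact ENNReal.inv_mul_cancel (by exact_mod_cast hn.ne') (ENNReal.natCast_ne_top n)⟩

lemma integral_empirical {f : Ω → ℝ} (hf : Measurable f) {a b : ℝ}
    (hab : ∀ ω, f ω ∈ Set.Icc a b) (s : Fin n → Ω) :
    ∫ ω, f ω ∂(empirical s) = (n : ℝ)⁻¹ * ∑ i, f (s i) := by
  rw [empirical, integral_smul_measure, integral_finsetSum_measure fun i _ =>
    Integrable.of_mem_Icc a b hf.aemeasurable (ae_of_all _ hab)]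
  simp [integral_dirac' _ _ hf.stronglyMeasurable]

/-- Hoeffding's inequality for the deviation of an empirical mean above the mean. -/
lemma measureReal_le_empirical_sub_le {f : Ω → ℝ} (hf : Measurable f) {a W t : ℝ}
    (hab : ∀ ω, f ω ∈ Set.Icc a (a + W)) (ht : 0 ≤ t) (hn : 0 < n) :
    (Measure.pi fun _ : Fin n => P).real
      {s | t ≤ ∫ ω, f ω ∂(empirical s) - ∫ ω, f ω ∂P} ≤ Real.exp (-(2 * n * t ^ 2 / W ^ 2)) := by
  have hn' : (0 : ℝ) < n := by exact_mod_cast hn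
  set μ := Measure.pi fun _ : Fin n => P with hμ
  have hae : ∀ i : Fin n, AEMeasurable (fun s : Fin n → Ω => f (s i)) μ := fun i =>
    (hf.comp (measurable_pi_apply i)).aemeasurable
  have hmean : ∀ i : Fin n, ∫ s, f (s i) ∂μ = ∫ ω, f ω ∂P := fun i =>
    integral_comp_eval (μ := fun _ : Fin n => P) hf.aestronglyMeasurable
  have hsub : ∀ i ∈ (Finset.univ : Finset (Fin n)),
      ProbabilityTheory.HasSubgaussianMGF (fun s : Fin n → Ω => f (s i) - ∫ ω, f ω ∂P)
        ((‖a + W - a‖₊ / 2) ^ 2) μ := fun i _ => by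
    have := ProbabilityTheory.hasSubgaussianMGF_of_mem_Icc (hae i)
      (ae_of_all _ fun s => hab (s i))
    rwa [hmean i] at this
  have hind : ProbabilityTheory.iIndepFun
      (fun (i : Fin n) (s : Fin n → Ω) => f (s i) - ∫ ω, f ω ∂P) μ :=
    ProbabilityTheory.iIndepFun_pi (X := fun (_ : Fin n) ω => f ω - ∫ ω, f ω ∂P)
      fun _ => (hf.sub_const _).aemeasurable
  have h := ProbabilityTheory.HasSubgaussianMGF.measure_sum_ge_le_of_iIndepFun hind hsub
    (mul_nonneg hn'.le ht)
  have hset : {s : Fin n → Ω | t ≤ ∫ ω, f ω ∂(empirical s) - ∫ ω, f ω ∂P} =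
      {s | n * t ≤ ∑ i, (f (s i) - ∫ ω, f ω ∂P)} := by
    ext s
    simp only [Set.mem_ofPred_eq, integral_empirical hf hab, Finset.sum_sub_distrib,
      Finset.sum_const, Finset.card_univ, Fintype.card_fin, nsmul_eq_mul]
    rw [← mul_le_mul_iff_right₀ hn', mul_sub, mul_inv_cancel_left₀ hn'.ne']
  rw [hset]
  refine h.trans_eq ?_
  congr 1
  simp only [add_sub_cancel_left, Finset.sum_const, Finset.card_univ, Fintype.card_fin,
    nsmul_eq_mul, NNReal.coe_mul, NNReal.coe_natCast, NNReal.coe_pow, NNReal.coe_div, coe_nnnorm,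
    NNReal.coe_ofNat, Real.norm_eq_abs, div_pow, sq_abs]
  -- For `W = 0` division by zero makes both exponents 0.
  by_cases hW : W = 0
  · simp [hW]
  · field_simp

lemma measureReal_le_sub_empirical_le {f : Ω → ℝ} (hf : Measurable f) {a W t : ℝ}
    (hab : ∀ ω, f ω ∈ Set.Icc a (a + W)) (ht : 0 ≤ t) (hn : 0 < n) :
    (Measure.pi fun _ : Fin n => P).real
      {s | t ≤ ∫ ω, f ω ∂P - ∫ ω, f ω ∂(empirical s)} ≤ Real.exp (-(2 * n * t ^ 2 / W ^ 2)) := by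
  have h := measureReal_le_empirical_sub_le (P := P) (a := -(a + W)) hf.neg
    (fun ω => ⟨neg_le_neg (hab ω).2, by simp only [Pi.neg_apply]; linarith [(hab ω).1]⟩) ht hn
  simpa only [Pi.neg_apply, integral_neg, neg_sub_neg] using h

/-- The robust functional and its truncated sample version are close with high probability. -/
lemma measureReal_deviation_le (hX : Measurable X) (hXB : ∀ ω, X ω ∈ Set.Icc (-B) B)
    (hB : 0 < B) {φ : ℝ → ℝ≥0∞} (hφ : IsDivergence φ) {τ ε : ℝ} (hτ : 0 < τ) (hε : 0 < ε)
    (hL : 1 ≤ L) (hg : ∀ x, L < x → ENNReal.ofReal (32 * B * τ / ε * x) ≤ φ x) (hn : 0 < n) :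
    (Measure.pi fun _ : Fin n => P).real
      {s | ε / 2 < |robust φ τ P X - saa (truncate φ L) τ X s|} ≤
      ((32 * B / ε + 2) * (32 * B * L / ε + 1) + 1) *
        Real.exp (-(2 * n * (ε / 8) ^ 2 / ((2 + 2 * L) * B) ^ 2)) := by
  set ψ := truncate φ L with hψdef
  have hψ : IsBoundedDivergence ψ L := isBoundedDivergence_truncate hφ hL
  set μ := Measure.pi fun _ : Fin n => P with hμ
  set q := Real.exp (-(2 * n * (ε / 8) ^ 2 / ((2 + 2 * L) * B) ^ 2)) with hq
  have hη : 0 < ε / 16 := by positivity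
  have hL0 : 0 < L := by linarith
  obtain ⟨l, hl, m, hm, hdual⟩ := exists_integral_dualFn_le_robust (Q := P) hX hXB hB.le hψ hτ
  set F : ℕ × ℕ → Ω → ℝ := fun p ω =>
    dualFn ψ τ (p.1 * (ε / 16 / τ)) (-B + p.2 * (ε / 16 / L)) (X ω) with hF
  set I := ⌈2 * B / (ε / 16)⌉₊ with hI
  set J := ⌊2 * B * L / (ε / 16)⌋₊ with hJ
  set S : Finset (ℕ × ℕ) := Finset.range (I + 1) ×ˢ Finset.range (J + 1) with hS
  have hlp : ∀ i : ℕ, 0 ≤ (i : ℝ) * (ε / 16 / τ) := fun i => by positivity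
  have hmp : ∀ j ≤ J, -B + (j : ℝ) * (ε / 16 / L) ∈ Set.Icc (-B) B := by
    intro j hj
    have h0 : 0 ≤ (j : ℝ) * (ε / 16 / L) := by positivity
    have h1 : (j : ℝ) ≤ 2 * B * L / (ε / 16) :=
      (Nat.cast_le.2 hj).trans (Nat.floor_le (by positivity))
    have h2 : (j : ℝ) * (ε / 16 / L) ≤ 2 * B := by
      calc (j : ℝ) * (ε / 16 / L) ≤ 2 * B * L / (ε / 16) * (ε / 16 / L) := by gcongr
        _ = 2 * B := by field_simp
    constructor <;> linarith
  -- Off the bad events `R` exceeds the sample value by at most `ε / 16` (truncation) plus `ε / 8`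
  -- (deviation) plus `2 · ε / 16` (grid), and falls below it by at most `ε / 8`.
  have hsub : {s : Fin n → Ω | ε / 2 < |robust φ τ P X - saa ψ τ X s|} ⊆
      (⋃ p ∈ S, {s | ε / 8 ≤ ∫ ω, F p ω ∂P - ∫ ω, F p ω ∂(empirical s)}) ∪
        {s | ε / 8 ≤ ∫ ω, dualFn ψ τ l m (X ω) ∂(empirical s)
          - ∫ ω, dualFn ψ τ l m (X ω) ∂P} := by
    intro s hs
    by_contra hcon
    simp only [Set.mem_union, Set.mem_iUnion, Set.mem_ofPred_eq, not_or, not_exists, not_le] at hcon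
    obtain ⟨h1, h2⟩ := hcon
    have := isProbabilityMeasure_empirical hn s
    obtain ⟨i, hi, j, hj, hgrid⟩ :=
      exists_grid_integral_dualFn_le (Q := empirical s) hX hXB hB.le hψ hτ hη
    have h3 := h1 (i, j) (Finset.mem_product.2
      ⟨Finset.mem_range.2 (Nat.lt_succ_of_le hi), Finset.mem_range.2 (Nat.lt_succ_of_le hj)⟩)
    have h4 := robust_le_integral_dualFn (Q := P) hX hXB hψ hτ.le (hlp i)
      (-B + (j : ℝ) * (ε / 16 / L))
    have h5 := robust_le_robust_truncate (Q := P) hX hXB hB.le hφ hL hτ.le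
      (y := 32 * B * τ / ε) (by positivity) hg
    have h6 : 2 * B * τ / (32 * B * τ / ε) = ε / 16 := by field_simp; norm_num
    have h7 := robust_le_integral_dualFn (Q := empirical s) hX hXB hψ hτ.le hl.1 m
    have h8 := robust_truncate_le (Q := P) hX hXB hφ.map_one hL τ
    simp only [Set.mem_ofPred_eq] at hs
    refine absurd hs (not_lt.2 (abs_le.2 ⟨?_, ?_⟩))
    · simp only [saa]
      linarith
    · simp only [saa]
      simp only [hF] at h3
      linarith
  have hA : ∀ p ∈ S, μ.real {s | ε / 8 ≤ ∫ ω, F p ω ∂P - ∫ ω, F p ω ∂(empirical s)} ≤ q := by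
    intro p hp
    have hp2 := Nat.lt_succ_iff.1 (Finset.mem_range.1 (Finset.mem_product.1 hp).2)
    exact measureReal_le_sub_empirical_le ((measurable_dualFn hψ τ (hlp _) _).comp hX)
      (fun ω => dualFn_mem_Icc hψ (hlp _) (hmp _ hp2) (hXB ω)) (by positivity) hn
  have hC : μ.real {s | ε / 8 ≤ ∫ ω, dualFn ψ τ l m (X ω) ∂(empirical s)
      - ∫ ω, dualFn ψ τ l m (X ω) ∂P} ≤ q :=
    measureReal_le_empirical_sub_le ((measurable_dualFn hψ τ hl.1 _).comp hX)
      (fun ω => dualFn_mem_Icc hψ hl.1 hm (hXB ω)) (by positivity) hn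
  have hcard : (S.card : ℝ) ≤ (32 * B / ε + 2) * (32 * B * L / ε + 1) := by
    rw [hS, Finset.card_product, Finset.card_range, Finset.card_range]
    push_cast
    have h1 : (I : ℝ) < 2 * B / (ε / 16) + 1 := Nat.ceil_lt_add_one (by positivity)
    have h2 : (J : ℝ) ≤ 2 * B * L / (ε / 16) := Nat.floor_le (by positivity)
    have e1 : 2 * B / (ε / 16) = 32 * B / ε := by field_simp; norm_num
    have e2 : 2 * B * L / (ε / 16) = 32 * B * L / ε := by field_simp; norm_num
    rw [e1] at h1
    rw [e2] at h2
    exact mul_le_mul (by linarith) (by linarith) (by positivity) (by positivity)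
  have hq0 : 0 ≤ q := (Real.exp_pos _).le
  calc μ.real {s : Fin n → Ω | ε / 2 < |robust φ τ P X - saa ψ τ X s|}
      ≤ _ := measureReal_mono hsub
    _ ≤ _ := measureReal_union_le _ _
    _ ≤ (∑ p ∈ S, μ.real {s | ε / 8 ≤ ∫ ω, F p ω ∂P - ∫ ω, F p ω ∂(empirical s)}) + q :=
        add_le_add (measureReal_biUnion_finset_le _ _) hC
    _ ≤ S.card * q + q := by
        gcongr
        rw [← nsmul_eq_mul]
        exact Finset.sum_le_card_nsmul _ _ _ hA
    _ ≤ ((32 * B / ε + 2) * (32 * B * L / ε + 1)) * q + q := by gcongr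
    _ = _ := by ring

omit [IsProbabilityMeasure P] in
-- A countable family of grids, with mesh parameter `1 / (k + 1)`, attains the dual value in the
-- limit. This writes the sample value as a countable infimum of measurable functions.
lemma saa_eq_iInf (hX : Measurable X) (hXB : ∀ ω, X ω ∈ Set.Icc (-B) B) (hB : 0 ≤ B)
    (hψ : IsBoundedDivergence ψ L) {τ : ℝ} (hτ : 0 < τ) (hn : 0 < n) (s : Fin n → Ω) :
    saa ψ τ X s = ⨅ p : ℕ × ℕ × ℕ, ∫ ω, dualFn ψ τ (p.2.1 * (1 / (p.1 + 1 : ℝ) / τ))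
      (-B + p.2.2 * (1 / (p.1 + 1 : ℝ) / L)) (X ω) ∂(empirical s) := by
  have := isProbabilityMeasure_empirical hn s
  have hle : ∀ p : ℕ × ℕ × ℕ, saa ψ τ X s ≤
      ∫ ω, dualFn ψ τ (p.2.1 * (1 / (p.1 + 1 : ℝ) / τ))
      (-B + p.2.2 * (1 / (p.1 + 1 : ℝ) / L)) (X ω) ∂(empirical s) := fun p =>
    robust_le_integral_dualFn hX hXB hψ hτ.le (by positivity) _
  refine le_antisymm (le_ciInf hle) (le_of_forall_pos_le_add fun δ hδ => ?_)
  obtain ⟨k, hk⟩ := exists_nat_one_div_lt (half_pos hδ)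
  obtain ⟨i, -, j, -, h⟩ := exists_grid_integral_dualFn_le (Q := empirical s) hX hXB hB hψ hτ
    (η := 1 / (k + 1 : ℝ)) (by positivity)
  refine (ciInf_le ⟨saa ψ τ X s, ?_⟩ (k, i, j)).trans (h.trans ?_)
  · rintro _ ⟨p, rfl⟩
    exact hle p
  · simp only [saa]
    linarith

omit [IsProbabilityMeasure P] in
lemma measurable_integral_empirical {f : Ω → ℝ} (hf : Measurable f) {a b : ℝ}
    (hab : ∀ ω, f ω ∈ Set.Icc a b) :
    Measurable fun s : Fin n → Ω => ∫ ω, f ω ∂(empirical s) := by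
  simp only [integral_empirical hf hab]
  exact (Finset.measurable_sum _ fun i _ => hf.comp (measurable_pi_apply i)).const_mul _

omit [MeasurableSpace Ω] in
lemma exists_dualFn_mem_Icc (hXB : ∀ ω, X ω ∈ Set.Icc (-B) B) (hψ : IsBoundedDivergence ψ L)
    {τ l : ℝ} (hl : 0 ≤ l) (m : ℝ) : ∃ a b, ∀ ω, dualFn ψ τ l m (X ω) ∈ Set.Icc a b :=
  ⟨_, _, fun ω => dualFn_mem_Icc hψ (B := max B |m|) hl (abs_le.1 (le_max_right _ _))
    ⟨by linarith [(hXB ω).1, le_max_left B |m|], (hXB ω).2.trans (le_max_left _ _)⟩⟩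

omit [IsProbabilityMeasure P] in
lemma measurable_saa_of_isBoundedDivergence (hX : Measurable X)
    (hXB : ∀ ω, X ω ∈ Set.Icc (-B) B) (hB : 0 ≤ B)
    (hψ : IsBoundedDivergence ψ L) {τ : ℝ} (hτ : 0 < τ) (hn : 0 < n) :
    Measurable fun s : Fin n → Ω => saa ψ τ X s := by
  simp only [saa_eq_iInf hX hXB hB hψ hτ hn]
  refine Measurable.iInf fun p => ?_
  have hl : 0 ≤ (p.2.1 * (1 / (p.1 + 1 : ℝ) / τ)) := by positivity
  obtain ⟨a, b, hab⟩ := exists_dualFn_mem_Icc hXB hψ (τ := τ) hl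
    (-B + p.2.2 * (1 / (p.1 + 1 : ℝ) / L))
  exact measurable_integral_empirical ((measurable_dualFn hψ τ hl _).comp hX) hab

/-- Superlinear growth provides a truncation level for each slope, and `growthInv` is one. -/
lemma le_growthInv_and_forall_lt {φ : ℝ → ℝ≥0∞} (hgr : SuperlinearGrowth φ) {D : ℝ} (hD : 1 ≤ D)
    {y : ℝ} (hy : 0 ≤ y) :
    D ≤ growthInv φ D y ∧ ∀ x, growthInv φ D y < x → ENNReal.ofReal (y * x) ≤ φ x := by
  have hne : {x : ℝ | D ≤ x ∧ ENNReal.ofReal y ≤ growth φ x}.Nonempty := by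
    have h := (tendsto_order.1 hgr).1 (ENNReal.ofReal y) ENNReal.ofReal_lt_top
    obtain ⟨x0, hx0⟩ := eventually_atTop.1 h
    refine ⟨max x0 D, le_max_right _ _, le_iInf₂ fun x hx => (hx0 x ?_).le⟩
    exact (le_max_left _ _).trans hx
  have hD' : D ≤ growthInv φ D y := le_csInf hne fun x hx => hx.1
  refine ⟨hD', fun x hx => ?_⟩
  -- The infimum need not be attained, so the growth bound is drawn from an admissible `z < x`.
  obtain ⟨z, hz, hzx⟩ := exists_lt_of_csInf_lt hne hx
  have h := hz.2.trans (iInf₂_le x hzx.le)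
  have hx0 : 0 < x := by linarith
  rw [ENNReal.le_div_iff_mul_le (Or.inl (by simpa using hx0)) (Or.inl ENNReal.ofReal_ne_top),
    ← ENNReal.ofReal_mul hy] at h
  exact h

omit [IsProbabilityMeasure P] in
-- Truncation at slope `k + 1` has error at most `2 B τ / (k + 1)` for every sample, so the
-- functional is a pointwise limit of truncated ones, which are measurable.
lemma measurable_saa (hX : Measurable X)
    (hXB : ∀ ω, X ω ∈ Set.Icc (-B) B) (hB : 0 ≤ B) {φ : ℝ → ℝ≥0∞} (hφ : IsDivergence φ)
    (hgr : SuperlinearGrowth φ) {τ : ℝ} (hτ : 0 < τ) (hn : 0 < n) :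
    Measurable fun s : Fin n → Ω => saa φ τ X s := by
  set K : ℕ → ℝ := fun k => growthInv φ 1 (k + 1 : ℝ) with hK
  have hspec : ∀ k : ℕ, 1 ≤ K k ∧ ∀ x, K k < x → ENNReal.ofReal ((k + 1 : ℝ) * x) ≤ φ x :=
    fun k => le_growthInv_and_forall_lt hgr le_rfl (by positivity)
  refine measurable_of_tendsto_metrizable (f := fun k (s : Fin n → Ω) =>
    saa (truncate φ (K k)) τ X s) (fun k => measurable_saa_of_isBoundedDivergence hX hXB hB
      (isBoundedDivergence_truncate hφ (hspec k).1) hτ hn) ?_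
  refine tendsto_pi_nhds.2 fun s => ?_
  have := isProbabilityMeasure_empirical hn s
  have hlim : Tendsto (fun k : ℕ => saa φ τ X s - 2 * B * τ * (1 / (k + 1 : ℝ))) atTop
      (𝓝 (saa φ τ X s - 2 * B * τ * 0)) :=
    tendsto_const_nhds.sub (tendsto_one_div_add_atTop_nhds_zero_nat.const_mul _)
  rw [mul_zero, sub_zero] at hlim
  refine tendsto_of_tendsto_of_tendsto_of_le_of_le hlim tendsto_const_nhds (fun k => ?_)
    (fun k => robust_truncate_le hX hXB hφ.map_one (hspec k).1 τ)
  have := robust_le_robust_truncate (Q := empirical s) hX hXB hB hφ (hspec k).1 hτ.le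
    (by positivity) (hspec k).2
  have e : 2 * B * τ / (k + 1 : ℝ) = 2 * B * τ * (1 / (k + 1 : ℝ)) := by ring
  simp only [saa]
  linarith

lemma integral_integral_empirical {f : Ω → ℝ} (hf : Measurable f) {a b : ℝ}
    (hab : ∀ ω, f ω ∈ Set.Icc a b) (hn : 0 < n) :
    ∫ s, (∫ ω, f ω ∂(empirical s)) ∂(Measure.pi fun _ : Fin n => P) = ∫ ω, f ω ∂P := by
  have hi : ∀ i : Fin n, Integrable (fun s : Fin n → Ω => f (s i))
      (Measure.pi fun _ : Fin n => P) := fun i =>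
    Integrable.of_mem_Icc a b (hf.comp (measurable_pi_apply i)).aemeasurable
      (ae_of_all _ fun s => hab (s i))
  have hmean : ∀ i : Fin n, ∫ s, f (s i) ∂(Measure.pi fun _ : Fin n => P) = ∫ ω, f ω ∂P := fun i =>
    integral_comp_eval (μ := fun _ : Fin n => P) hf.aestronglyMeasurable
  simp only [integral_empirical hf hab]
  rw [integral_const_mul, integral_finsetSum _ fun i _ => hi i]
  simp only [hmean, Finset.sum_const, Finset.card_univ, Fintype.card_fin, nsmul_eq_mul]
  exact inv_mul_cancel_left₀ (by exact_mod_cast hn.ne') _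

lemma integrable_saa (hX : Measurable X)
    (hXB : ∀ ω, X ω ∈ Set.Icc (-B) B) (hB : 0 ≤ B) {φ : ℝ → ℝ≥0∞} (hφ : IsDivergence φ)
    (hgr : SuperlinearGrowth φ) {τ : ℝ} (hτ : 0 < τ) (hn : 0 < n) :
    Integrable (fun s : Fin n → Ω => saa φ τ X s) (Measure.pi fun _ : Fin n => P) :=
  Integrable.of_mem_Icc (-B) B (measurable_saa hX hXB hB hφ hgr hτ hn).aemeasurable
    (ae_of_all _ fun s => by
      have := isProbabilityMeasure_empirical hn s
      exact abs_le.1 (abs_robust_le hX hXB hφ.map_one τ))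

/-- The sample average approximation is biased downwards. -/
lemma integral_saa_le_robust (hX : Measurable X)
    (hXB : ∀ ω, X ω ∈ Set.Icc (-B) B) (hB : 0 ≤ B) {φ : ℝ → ℝ≥0∞} (hφ : IsDivergence φ)
    (hgr : SuperlinearGrowth φ) {τ : ℝ} (hτ : 0 < τ) (hn : 0 < n) :
    ∫ s, saa φ τ X s ∂(Measure.pi fun _ : Fin n => P) ≤ robust φ τ P X := by
  have key : ∀ k : ℕ, ∫ s, saa φ τ X s ∂(Measure.pi fun _ : Fin n => P) ≤
      robust φ τ P X + 2 * B * τ * (1 / (k + 1 : ℝ)) := by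
    intro k
    obtain ⟨hL, hg⟩ := le_growthInv_and_forall_lt hgr (D := 1) le_rfl
      (y := (k + 1 : ℝ)) (by positivity)
    set K := growthInv φ 1 (k + 1 : ℝ)
    have hψ := isBoundedDivergence_truncate hφ hL
    obtain ⟨l, hl, m, hm, h⟩ := exists_integral_dualFn_le_robust (Q := P) hX hXB hB hψ hτ
    obtain ⟨a, b, hab⟩ := exists_dualFn_mem_Icc hXB hψ (τ := τ) hl.1 m
    have hf := (measurable_dualFn hψ τ hl.1 m).comp hX
    have hmeas := measurable_integral_empirical (n := n) hf hab
    have hint : Integrable (fun s : Fin n → Ω => ∫ ω, dualFn (truncate φ K) τ l m (X ω)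
        ∂(empirical s)) (Measure.pi fun _ : Fin n => P) :=
      Integrable.of_mem_Icc a b hmeas.aemeasurable (ae_of_all _ fun s => by
        have := isProbabilityMeasure_empirical hn s
        have hi := integrable_dualFn (Q := empirical s) hX hXB hψ (τ := τ) hl.1 m
        have h1 := integral_mono (integrable_const a) hi fun ω => (hab ω).1
        have h2 := integral_mono hi (integrable_const b) fun ω => (hab ω).2
        simp only [integral_const, probReal_univ, one_smul] at h1 h2
        exact ⟨h1, h2⟩)
    calc ∫ s, saa φ τ X s ∂(Measure.pi fun _ : Fin n => P)
        ≤ ∫ s, ((∫ ω, dualFn (truncate φ K) τ l m (X ω) ∂(empirical s)) +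
            2 * B * τ * (1 / (k + 1 : ℝ))) ∂(Measure.pi fun _ : Fin n => P) := by
          refine integral_mono (integrable_saa hX hXB hB hφ hgr hτ hn)
            (hint.add (integrable_const _)) fun s => ?_
          have := isProbabilityMeasure_empirical hn s
          have h1 := robust_le_robust_truncate (Q := empirical s) hX hXB hB hφ hL hτ.le
            (by positivity) hg
          have h2 := robust_le_integral_dualFn (Q := empirical s) hX hXB hψ hτ.le hl.1 m
          have e : 2 * B * τ / (k + 1 : ℝ) = 2 * B * τ * (1 / (k + 1 : ℝ)) := by ring
          simp only [saa]
          linarith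
      _ = ∫ ω, dualFn (truncate φ K) τ l m (X ω) ∂P + 2 * B * τ * (1 / (k + 1 : ℝ)) := by
          rw [integral_add hint (integrable_const _)]
          have := integral_integral_empirical (P := P) (n := n) hf hab hn
          simp only [Function.comp_apply] at this
          rw [this]
          simp
      _ ≤ robust φ τ P X + 2 * B * τ * (1 / (k + 1 : ℝ)) := by
          have := robust_truncate_le (Q := P) hX hXB hφ.map_one hL τ
          linarith
  have hlim : Tendsto (fun k : ℕ => robust φ τ P X + 2 * B * τ * (1 / (k + 1 : ℝ))) atTop
      (𝓝 (robust φ τ P X + 2 * B * τ * 0)) :=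
    tendsto_const_nhds.add (tendsto_one_div_add_atTop_nhds_zero_nat.const_mul _)
  rw [mul_zero, add_zero] at hlim
  exact ge_of_tendsto' hlim key

end Sampling

/-! ### From the tail bound to the explicit sample sizes. -/

section Rates

variable {Ω : Type*} [MeasurableSpace Ω] {P : Measure Ω} [IsProbabilityMeasure P]
  {X : Ω → ℝ} {B : ℝ} {n : ℕ}

/-- By AM-GM, `b ^ 2 / τ ≥ (L + 1 + τ) ^ 2 / τ ≥ 4 (L + 1)`. With `r = B / ε > 1 / 2`, the number
`A` inside the logarithm (without `δ`) is at least `1024 r ^ 2 (L + 1) ≥ 512`, and the union-bound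
count is at most `2 A ≤ A ^ 2`. -/
lemma prefactor_le {τ ε L b : ℝ} (hτ : 0 < τ) (hε : 0 < ε) (hεB : ε < 2 * B) (hL : 1 ≤ L)
    (hb : L + 1 + τ ≤ b) :
    512 ≤ 256 * B ^ 2 * b ^ 2 / (τ * ε ^ 2) ∧
    (32 * B / ε + 2) * (32 * B * L / ε + 1) + 1 ≤ (256 * B ^ 2 * b ^ 2 / (τ * ε ^ 2)) ^ 2 := by
  obtain ⟨r, hr⟩ : ∃ r, r = B / ε := ⟨_, rfl⟩
  have hr1 : 1 < 2 * r := by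
    rw [hr, ← mul_div_assoc, lt_div_iff₀ hε]; linarith
  have e1 : 32 * B / ε = 32 * r := by rw [hr]; ring
  have e2 : 32 * B * L / ε = 32 * r * L := by rw [hr]; ring
  have e3 : 256 * B ^ 2 * b ^ 2 / (τ * ε ^ 2) = 256 * r ^ 2 * (b ^ 2 / τ) := by
    rw [hr]; field_simp
  have hbτ : 4 * (L + 1) ≤ b ^ 2 / τ := by
    rw [le_div_iff₀ hτ]
    have h1 : (L + 1 + τ) ^ 2 ≤ b ^ 2 := pow_le_pow_left₀ (by linarith) hb 2
    nlinarith [sq_nonneg (L + 1 - τ)]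
  have hr2 : 1 < 4 * r ^ 2 := by nlinarith
  have hA : 1024 * r ^ 2 * (L + 1) ≤ 256 * r ^ 2 * (b ^ 2 / τ) := by
    have := mul_le_mul_of_nonneg_left hbτ (show 0 ≤ 256 * r ^ 2 by positivity)
    linarith
  rw [e1, e2, e3]
  have h512 : 512 ≤ 256 * r ^ 2 * (b ^ 2 / τ) := by
    refine le_trans ?_ hA
    nlinarith
  refine ⟨h512, ?_⟩
  set A := 256 * r ^ 2 * (b ^ 2 / τ)
  have hN : (32 * r + 2) * (32 * r * L + 1) + 1 ≤ 2 * A := by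
    have h1 : 32 * r + 2 ≤ 36 * r := by linarith
    have h2 : 32 * r * L + 1 ≤ 34 * r * L := by nlinarith
    have h3 : (32 * r + 2) * (32 * r * L + 1) ≤ 36 * r * (34 * r * L) :=
      mul_le_mul h1 h2 (by nlinarith) (by linarith)
    nlinarith
  nlinarith

lemma le_lipConst {φ : ℝ → ℝ≥0∞} {D τ ε : ℝ} (hB : 0 ≤ B) (hτ : 0 < τ) (hε : 0 < ε)
    (hL : 1 ≤ truncLevel φ D B τ ε) :
    truncLevel φ D B τ ε + 1 + τ ≤ lipConst φ D B τ ε := by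
  have : 0 ≤ 2 * (1 + truncLevel φ D B τ ε) * B / lamLower τ ε := by
    unfold lamLower
    positivity
  unfold lipConst
  linarith

lemma measureReal_failure_le (hX : Measurable X) (hXB : ∀ ω, X ω ∈ Set.Icc (-B) B)
    {φ : ℝ → ℝ≥0∞} (hφ : IsDivergence φ) (hgr : SuperlinearGrowth φ) {D : ℝ} (hD : 1 ≤ D)
    {τ ε δ : ℝ} (hτ : 0 < τ) (hε : 0 < ε) (hεB : ε < 2 * B) (hδ : 0 < δ) (hδ1 : δ < 1)
    (hn : 0 < n)
    (hnb : 128 * boundConst φ D B τ ε ^ 2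
      * Real.log (256 * B ^ 2 * lipConst φ D B τ ε ^ 2 / (τ * ε ^ 2 * δ)) / ε ^ 2 ≤ (n : ℝ)) :
    (Measure.pi fun _ : Fin n => P).real
      {s | ε / 2 < |robust φ τ P X - saa (truncate φ (truncLevel φ D B τ ε)) τ X s|} ≤ δ := by
  have hB : 0 < B := by linarith
  obtain ⟨hDL, hg⟩ := le_growthInv_and_forall_lt hgr hD (y := 32 * B * τ / ε) (by positivity)
  change D ≤ truncLevel φ D B τ ε at hDL
  change ∀ x, truncLevel φ D B τ ε < x → _ at hg
  have hlip := le_lipConst hB.le hτ hε (hD.trans hDL)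
  unfold boundConst at hnb
  set L := truncLevel φ D B τ ε
  set b := lipConst φ D B τ ε
  have hL : 1 ≤ L := hD.trans hDL
  obtain ⟨hA1, hA2⟩ := prefactor_le hτ hε hεB hL hlip
  have hA : 256 * B ^ 2 * b ^ 2 / (τ * ε ^ 2 * δ) = 256 * B ^ 2 * b ^ 2 / (τ * ε ^ 2) / δ := by
    rw [div_div]
  rw [hA] at hnb
  set A := 256 * B ^ 2 * b ^ 2 / (τ * ε ^ 2)
  have hA0 : 0 < A := by linarith
  have hx1 : 1 ≤ A / δ := by rw [le_div_iff₀ hδ]; linarith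
  have hx0 : 0 < A / δ := by linarith
  have hlog : 0 ≤ Real.log (A / δ) := Real.log_nonneg hx1
  refine (measureReal_deviation_le hX hXB hB hφ hτ hε hL hg hn).trans ?_
  -- Here `2 n (ε / 8) ^ 2 = n ε ^ 2 / 32` and `128 / 32 = 4`: the tail is at most `(δ / A) ^ 4`,
  -- which beats the prefactor `A ^ 2`.
  have hexp : 4 * Real.log (A / δ) ≤ 2 * n * (ε / 8) ^ 2 / ((2 + 2 * L) * B) ^ 2 := by
    have hW : 0 < (2 + 2 * L) * B := by positivity
    rw [le_div_iff₀ (by positivity)]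
    have h1 : ((2 + 2 * L) * B) ^ 2 ≤ ((3 + 2 * L) * B) ^ 2 :=
      pow_le_pow_left₀ hW.le (by nlinarith) 2
    rw [div_le_iff₀ (by positivity)] at hnb
    have h2 := mul_le_mul_of_nonneg_right h1 hlog
    nlinarith
  have hpow : Real.exp (-(2 * n * (ε / 8) ^ 2 / ((2 + 2 * L) * B) ^ 2)) ≤ ((A / δ) ^ 4)⁻¹ := by
    calc Real.exp (-(2 * n * (ε / 8) ^ 2 / ((2 + 2 * L) * B) ^ 2))
        ≤ Real.exp (-(4 * Real.log (A / δ))) := Real.exp_le_exp.2 (neg_le_neg hexp)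
      _ = ((A / δ) ^ 4)⁻¹ := by
        rw [Real.exp_neg, ← Real.log_rpow hx0, Real.exp_log (by positivity)]
        norm_cast
  calc ((32 * B / ε + 2) * (32 * B * L / ε + 1) + 1) *
        Real.exp (-(2 * n * (ε / 8) ^ 2 / ((2 + 2 * L) * B) ^ 2))
      ≤ A ^ 2 * ((A / δ) ^ 4)⁻¹ := by
        have := Real.exp_pos (-(2 * n * (ε / 8) ^ 2 / ((2 + 2 * L) * B) ^ 2))
        gcongr
    _ = δ * (δ ^ 3 * (A ^ 2)⁻¹) := by field_simp
    _ ≤ δ * 1 := by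
        have h1 : δ ^ 3 ≤ 1 := pow_le_one₀ hδ.le hδ1.le
        have h2 : (A ^ 2)⁻¹ ≤ 1 := inv_le_one_of_one_le₀ (by nlinarith)
        gcongr
        exact mul_le_one₀ h1 (by positivity) h2
    _ = δ := mul_one δ

/-- Only subadditivity is used, so neither set has to be measurable. -/
lemma ofReal_one_sub_le_measure {Ω' : Type*} [MeasurableSpace Ω'] {μ : Measure Ω'}
    [IsProbabilityMeasure μ] {S T : Set Ω'} {δ : ℝ} (hS : μ.real S ≤ δ) (hST : Sᶜ ⊆ T) : ENNReal.ofReal (1 - δ) ≤ μ T := by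
  have h1 : (1 : ℝ) ≤ μ.real S + μ.real T := by
    rw [← probReal_univ (μ := μ)]
    refine (measureReal_mono (fun x _ => ?_)).trans (measureReal_union_le S T)
    by_cases hx : x ∈ S
    · exact Or.inl hx
    · exact Or.inr (hST hx)
  rw [← ofReal_measureReal]
  exact ENNReal.ofReal_le_ofReal (by linarith)

lemma robust_sub_le_integral_saa (hX : Measurable X) (hXB : ∀ ω, X ω ∈ Set.Icc (-B) B)
    {φ : ℝ → ℝ≥0∞} (hφ : IsDivergence φ) (hgr : SuperlinearGrowth φ) {D : ℝ} (hD : 1 ≤ D)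
    {τ ε : ℝ} (hτ : 0 < τ) (hε : 0 < ε) (hεB : ε < 2 * B) (hn : 0 < n)
    (hnb : 512 * boundConst φ D B τ ε ^ 2
      * Real.log (8192 * B ^ 3 * lipConst φ D B τ ε ^ 2 / (τ * ε ^ 3)) / ε ^ 2 ≤ (n : ℝ)) :
    robust φ τ P X - ε ≤ ∫ s, saa φ τ X s ∂(Measure.pi fun _ : Fin n => P) := by
  have hB : 0 < B := by linarith
  obtain ⟨hDL, -⟩ := le_growthInv_and_forall_lt hgr hD (y := 32 * B * τ / ε) (by positivity)
  change D ≤ truncLevel φ D B τ ε at hDL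
  have hL : 1 ≤ truncLevel φ D B τ ε := hD.trans hDL
  have hψ := isBoundedDivergence_truncate hφ hL
  have hlip := le_lipConst hB.le hτ hε hL
  -- With `δ = ε / (32 B)` the failure event, where the loss is at most `2 B`, contributes `ε / 16`
  -- on top of `ε / 2`. This `δ` also turns `256 B ^ 2` into `8192 B ^ 3 / ε` inside the logarithm.
  have hδ : 0 < ε / (32 * B) := by positivity
  have hδ1 : ε / (32 * B) < 1 := by rw [div_lt_one (by positivity)]; linarith
  have harg : 256 * B ^ 2 * lipConst φ D B τ ε ^ 2 / (τ * ε ^ 2 * (ε / (32 * B))) =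
      8192 * B ^ 3 * lipConst φ D B τ ε ^ 2 / (τ * ε ^ 3) := by
    field_simp
    ring
  have hA1 := (prefactor_le hτ hε hεB hL hlip).1
  have hlog : 0 ≤ Real.log (256 * B ^ 2 * lipConst φ D B τ ε ^ 2 / (τ * ε ^ 2 * (ε / (32 * B)))) := by
    rw [← div_div _ (τ * ε ^ 2)]
    refine Real.log_nonneg ?_
    rw [le_div_iff₀ hδ]
    linarith
  rw [← harg] at hnb
  have hfail := measureReal_failure_le (P := P) hX hXB hφ hgr hD hτ hε hεB hδ hδ1 hn (by
    refine le_trans ?_ hnb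
    gcongr
    norm_num)
  set L := truncLevel φ D B τ ε
  set μ := Measure.pi fun _ : Fin n => P
  set S : Set (Fin n → Ω) := {s | ε / 2 < |robust φ τ P X - saa (truncate φ L) τ X s|} with hS
  have hSm : MeasurableSet S :=
    measurableSet_lt measurable_const
      ((measurable_const.sub (measurable_saa_of_isBoundedDivergence hX hXB hB.le hψ hτ hn)).norm)
  have hi : Integrable (fun s => robust φ τ P X - ε / 2 - 2 * B * S.indicator 1 s) μ :=
    (integrable_const _).sub (((integrable_const (1 : ℝ)).indicator hSm).const_mul _)
  have hval : ∫ s, (robust φ τ P X - ε / 2 - 2 * B * S.indicator 1 s) ∂μ =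
      robust φ τ P X - ε / 2 - 2 * B * μ.real S := by
    have h1 : Integrable (fun s => 2 * B * S.indicator (1 : (Fin n → Ω) → ℝ) s) μ :=
      ((integrable_const (1 : ℝ)).indicator hSm).const_mul _
    rw [integral_sub (integrable_const _) h1, integral_const_mul, integral_indicator_one hSm]
    simp
  have hle : ∫ s, (robust φ τ P X - ε / 2 - 2 * B * S.indicator 1 s) ∂μ ≤
      ∫ s, saa φ τ X s ∂μ := by
    refine integral_mono hi (integrable_saa hX hXB hB.le hφ hgr hτ hn) fun s => ?_
    have := isProbabilityMeasure_empirical hn s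
    have h1 := abs_le.1 (abs_robust_le (Q := P) hX hXB hφ.map_one τ)
    have h2 := abs_le.1 (abs_robust_le (Q := empirical s) hX hXB hφ.map_one τ)
    have h3 := robust_truncate_le (Q := empirical s) hX hXB hφ.map_one hL τ
    by_cases hs : s ∈ S
    · simp only [Set.indicator_of_mem hs, Pi.one_apply, saa]
      linarith [h1.2, h2.1]
    · have h4 : robust φ τ P X - saa (truncate φ L) τ X s ≤ ε / 2 :=
        (le_abs_self _).trans (not_lt.1 fun h => hs (by rwa [hS, Set.mem_ofPred_eq]))
      simp only [saa] at h4
      simp only [Set.indicator_of_notMem hs, saa]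
      linarith
  rw [hval] at hle
  have h5 := mul_le_mul_of_nonneg_left hfail (show 0 ≤ 2 * B by linarith)
  have h6 : 2 * B * (ε / (32 * B)) = ε / 16 := by field_simp; norm_num
  linarith

end Rates

end PhiDivergence
end



theorem mainTheorem7 {Ω : Type*} [MeasurableSpace Ω] (P : Measure Ω) [IsProbabilityMeasure P]
    (φ : ℝ → ℝ≥0∞) (hφ : PhiDivergence.IsDivergence φ)
    (hgrowth : PhiDivergence.SuperlinearGrowth φ)
    (D : ℝ) (hD : 1 ≤ D) (τ : ℝ) (hτ : 0 < τ) (B : ℝ) (hB : 0 ≤ B)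
    (X : Ω → ℝ) (hX : Measurable X) (hXB : ∀ ω, X ω ∈ Set.Icc (-B) B)
    (ε : ℝ) (hε : 0 < ε) :
    (∀ δ : ℝ, 0 < δ → δ < 1 → ∀ n : ℕ, 0 < n →
      128 * PhiDivergence.boundConst φ D B τ ε ^ 2
          * Real.log (256 * B ^ 2 * PhiDivergence.lipConst φ D B τ ε ^ 2 / (τ * ε ^ 2 * δ))
          / ε ^ 2 ≤ (n : ℝ) →
      ENNReal.ofReal (1 - δ) ≤
        Measure.pi (fun _ : Fin n => P)
          {s | |PhiDivergence.robust φ τ P X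
              - PhiDivergence.saa
                  (PhiDivergence.truncate φ (PhiDivergence.truncLevel φ D B τ ε)) τ X s| ≤ ε}) ∧
    (∀ n : ℕ, 0 < n →
      512 * PhiDivergence.boundConst φ D B τ ε ^ 2
          * Real.log (8192 * B ^ 3 * PhiDivergence.lipConst φ D B τ ε ^ 2 / (τ * ε ^ 3))
          / ε ^ 2 ≤ (n : ℝ) →
      Integrable (fun s : Fin n → Ω => PhiDivergence.saa φ τ X s)
          (Measure.pi (fun _ : Fin n => P)) ∧
      PhiDivergence.robust φ τ P X - ε
          ≤ ∫ s, PhiDivergence.saa φ τ X s ∂(Measure.pi (fun _ : Fin n => P)) ∧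
      ∫ s, PhiDivergence.saa φ τ X s ∂(Measure.pi (fun _ : Fin n => P))
          ≤ PhiDivergence.robust φ τ P X) := by
  open PhiDivergence in
  refine ⟨fun δ hδ hδ1 n hn hnb => ?_, fun n hn hnb =>
    ⟨integrable_saa hX hXB hB hφ hgrowth hτ hn, ?_,
      integral_saa_le_robust hX hXB hB hφ hgrowth hτ hn⟩⟩
  · rcases lt_or_ge ε (2 * B) with h | h
    · refine ofReal_one_sub_le_measure
        (measureReal_failure_le hX hXB hφ hgrowth hD hτ hε h hδ hδ1 hn hnb) fun s hs => ?_
      rw [Set.mem_compl_iff, Set.mem_ofPred_eq] at hs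
      rw [Set.mem_ofPred_eq]
      exact (not_lt.1 hs).trans (half_le_self hε.le)
    -- When `ε ≥ 2 B`, in particular when `B = 0`, both values lie in `[-B, B]` and no probability
    -- is lost.
    · refine ofReal_one_sub_le_measure (S := ∅) (by simpa using hδ.le) fun s _ => ?_
      have := isProbabilityMeasure_empirical hn s
      have hL := hD.trans (le_growthInv_and_forall_lt hgrowth hD
        (y := 32 * B * τ / ε) (by positivity)).1
      have h1 := abs_le.1 (abs_robust_le (Q := P) hX hXB hφ.map_one τ)
      have h2 : -B ≤ saa (truncate φ (truncLevel φ D B τ ε)) τ X s ∧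
          saa (truncate φ (truncLevel φ D B τ ε)) τ X s ≤ B :=
        abs_le.1 (abs_robust_le (Q := empirical s) hX hXB
          (isBoundedDivergence_truncate hφ hL).map_one τ)
      rw [Set.mem_ofPred_eq]
      refine abs_le.2 ⟨?_, ?_⟩
      · linarith [h1.1, h2.2]
      · linarith [h1.2, h2.1]
  · rcases lt_or_ge ε (2 * B) with h | h
    · exact robust_sub_le_integral_saa hX hXB hφ hgrowth hD hτ hε h hn hnb
    · have h1 := abs_le.1 (abs_robust_le (Q := P) hX hXB hφ.map_one τ)
      have h2 := integral_mono (integrable_const (-B))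
        (integrable_saa (P := P) (n := n) hX hXB hB hφ hgrowth hτ hn) fun s => by
          have := isProbabilityMeasure_empirical hn s
          exact (abs_le.1 (abs_robust_le hX hXB hφ.map_one τ)).1
      simp only [integral_const, probReal_univ, one_smul] at h2
      linarith [h1.2]
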